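/- Let $\mathcal{H}=\mathbb{C}^d$ with $d\ge 1$. A POVM on a finite-dimensional Hilbert space is a finite collection $\{A_j\}_j$ of positive semidefinite operators that sum to the identity; it is simple if its elements are pairwise linearly independent. A SIC on $\mathcal{H}$ is a POVM composed of $d^2$ elements of the form $\frac1d|\psi_j\rangle\langle\psi_j|$, $j=1,\dots,d^2$, with $|\langle\psi_j|\psi_k\rangle|^2=\frac{d\,\delta_{jk}+1}{d+1}$ for all $j,k$. For a POVM $\mathscr{C}=\{C_j\}_j$ on $\mathcal{H}^{\otimes N}$, the estimation fidelity is $$F(\mathscr{C})=\max_{\{\hat\rho_j\}}\ \sum_j\int \operatorname{tr}(\rho^{\otimes N}C_j)\,\operatorname{tr}(\rho\hat\rho_j)\,d\mu(\psi),\qquad \rho=|\psi\rangle\langle\psi|,$$ where $\mu$ is the normalized measure on the pure states of $\mathcal{H}$ induced by the Haar measure on the unitary group, and the maximum is over all choices of one density operator $\hat\rho_j$ on $\mathcal{H}$ for each outcome $j$. For POVMs $\mathscr{A}=\{A_j\}_j$ and $\mathscr{B}=\{B_k\}_k$ on $\mathcal{H}$ let $\mathscr{A}\otimes\mathscr{B}=\{A_j\otimes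 B_k\}_{j,k}$, $\mathscr{A}^{\otimes 2}=\mathscr{A}\otimes\mathscr{A}$, and let $$F_2^{\mathrm{iid}}=\frac{2\left[d^2+d+1+(d-1)\sqrt{d+1}\right]}{d(d+1)(d+2)}.$$ Two simple POVMs $\mathscr{A}$ and $\mathscr{B}$ on $\mathcal{H}$ are identical SICs up to relabeling (that is, both are SICs and they coincide after a bijective relabeling of their elements) if and only if $$F(\mathscr{A}\otimes\mathscr{B})=F(\mathscr{A}^{\otimes 2})=F_2^{\mathrm{iid}}.$$ -/

import Mathlib

namespace QMeas

open Matrix MeasureTheory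
open scoped Kronecker ComplexOrder

/-- A POVM with finitely many outcomes, labelled by `ι`, on the Hilbert space with orthonormal
basis labelled by `n`: a finite collection of positive semidefinite operators that sum up to the
identity. -/
structure POVM (n ι : Type*) [Fintype n] [DecidableEq n] [Fintype ι] where
  /-- the POVM elements -/
  elem : ι → Matrix n n ℂ
  posSemidef : ∀ j, (elem j).PosSemidef
  sum_eq_one : ∑ j, elem j = 1

/-- A POVM is simple if its elements are pairwise linearly independent. -/
def POVM.IsSimple {n ι : Type*} [Fintype n] [DecidableEq n] [Fintype ι] (A : POVM n ι) : Prop :=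
  Pairwise fun j k => LinearIndependent ℂ ![A.elem j, A.elem k]

/-- Two POVMs are identical up to relabeling of the outcomes. -/
def POVM.IdenticalUpToRelabeling {n ι κ : Type*} [Fintype n] [DecidableEq n] [Fintype ι]
    [Fintype κ] (A : POVM n ι) (B : POVM n κ) : Prop :=
  ∃ e : ι ≃ κ, ∀ j, A.elem j = B.elem (e j)

open Classical in
/-- A POVM on `ℂ^d` is a SIC if it consists of `d ^ 2` elements `(1 / d) |ψ_j⟩⟨ψ_j|` with
`|⟨ψ_j|ψ_k⟩|² = (d δ_jk + 1) / (d + 1)` for all `j`, `k`. -/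
def POVM.IsSIC {d : ℕ} {ι : Type*} [Fintype ι] (A : POVM (Fin d) ι) : Prop :=
  Fintype.card ι = d ^ 2 ∧
    ∃ ψ : ι → Fin d → ℂ,
      (∀ j, A.elem j = ((1 : ℂ) / (d : ℂ)) • vecMulVec (ψ j) (star (ψ j))) ∧
      ∀ j k, ‖star (ψ j) ⬝ᵥ ψ k‖ ^ 2 = ((d : ℝ) * (if j = k then 1 else 0) + 1) / ((d : ℝ) + 1)

/-- The product POVM `A ⊗ B = {A_j ⊗ B_k}` on two copies of `ℂ^d`; the product basis of
`ℂ^d ⊗ ℂ^d` is labelled by the functions `Fin 2 → Fin d`. -/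
noncomputable def POVM.prod {d : ℕ} {ι κ : Type*} [Fintype ι] [Fintype κ]
    (A : POVM (Fin d) ι) (B : POVM (Fin d) κ) : POVM (Fin 2 → Fin d) (ι × κ) where
  elem p := (A.elem p.1 ⊗ₖ B.elem p.2).submatrix
    (fun x : Fin 2 → Fin d => (x 0, x 1)) (fun x : Fin 2 → Fin d => (x 0, x 1))
  posSemidef p := ((A.posSemidef p.1).kronecker (B.posSemidef p.2)).submatrix _
  sum_eq_one := by
    ext x y
    have hA := congrFun (congrFun A.sum_eq_one (x 0)) (y 0)
    have hB := congrFun (congrFun B.sum_eq_one (x 1)) (y 1)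
    rw [Matrix.sum_apply] at hA hB
    simp only [Matrix.sum_apply, submatrix_apply, kroneckerMap_apply,
      Fintype.sum_prod_type, ← Finset.mul_sum, ← Finset.sum_mul]
    rw [hA, hB, Matrix.one_apply, Matrix.one_apply, Matrix.one_apply]
    have hxy : x = y ↔ x 0 = y 0 ∧ x 1 = y 1 := by
      rw [funext_iff, Fin.forall_fin_two]
    by_cases h0 : x 0 = y 0 <;> by_cases h1 : x 1 = y 1 <;> simp [hxy, h0, h1]

/-- The tensor power `ρ^{⊗N}` of an operator on `ℂ^d`; the product basis is labelled by the
functions `Fin N → Fin d`. -/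
noncomputable def tensorPow {d : ℕ} (N : ℕ) (ρ : Matrix (Fin d) (Fin d) ℂ) :
    Matrix (Fin N → Fin d) (Fin N → Fin d) ℂ :=
  Matrix.of fun x y => ∏ i, ρ (x i) (y i)

/-- Density operators: positive semidefinite operators of trace one. -/
def IsDensity {d : ℕ} (ρ : Matrix (Fin d) (Fin d) ℂ) : Prop :=
  ρ.PosSemidef ∧ ρ.trace = 1

noncomputable instance unitaryMeasurableSpace (d : ℕ) : MeasurableSpace (unitaryGroup (Fin d) ℂ) := borel _

instance unitaryBorelSpace (d : ℕ) : BorelSpace (unitaryGroup (Fin d) ℂ) := ⟨rfl⟩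

instance unitaryCompactSpace (d : ℕ) : CompactSpace (unitaryGroup (Fin d) ℂ) := by
  refine isCompact_iff_compactSpace.mp ?_
  have hK : IsCompact (Set.univ.pi fun _ : Fin d => Set.univ.pi fun _ : Fin d =>
      Metric.closedBall (0 : ℂ) 1) :=
    isCompact_univ_pi fun _ => isCompact_univ_pi fun _ => isCompact_closedBall _ _
  refine hK.of_isClosed_subset ?_ ?_
  · have h : ((unitaryGroup (Fin d) ℂ : Submonoid (Matrix (Fin d) (Fin d) ℂ)) :
        Set (Matrix (Fin d) (Fin d) ℂ)) = {U | star U * U = 1} := by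
      ext U
      exact mem_unitaryGroup_iff'
    rw [h]
    exact isClosed_eq (by fun_prop) continuous_const
  · intro U hU i _ j _
    simpa using entry_norm_bound_of_unitary hU i j

/-- The normalized Haar measure on the unitary group of `ℂ^d`. -/
noncomputable def haarUnitary (d : ℕ) : Measure (unitaryGroup (Fin d) ℂ) :=
  Measure.haarMeasure ⊤

/-- The pure state `U |0⟩⟨0| U†`. For Haar random `U` this is a Haar random pure state. -/
noncomputable def pureState {d : ℕ} [NeZero d] (U : unitaryGroup (Fin d) ℂ) : Matrix (Fin d) (Fin d) ℂ :=
  (U : Matrix (Fin d) (Fin d) ℂ) * Matrix.single 0 0 1 * (U : Matrix (Fin d) (Fin d) ℂ)ᴴ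

/-- The average fidelity `∑_j ∫ tr(ρ^{⊗N} A_j) tr(ρ σ_j) dρ` over Haar random pure states `ρ` of
the `N`-copy measurement `A` with estimators `σ_j`. -/
noncomputable def averageFidelity {d N : ℕ} [NeZero d] {ι : Type*} [Fintype ι]
    (A : POVM (Fin N → Fin d) ι) (σ : ι → Matrix (Fin d) (Fin d) ℂ) : ℝ :=
  ∑ j, ∫ U, (tensorPow N (pureState U) * A.elem j).trace.re * (pureState U * σ j).trace.re
    ∂(haarUnitary d)

/-- The estimation fidelity `F(A)` of an `N`-copy measurement: the maximum of the average fidelity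
over all choices of the estimators, which are density operators on `ℂ^d`. -/
noncomputable def estimationFidelity {d N : ℕ} [NeZero d] {ι : Type*} [Fintype ι]
    (A : POVM (Fin N → Fin d) ι) : ℝ :=
  sSup {f | ∃ σ : ι → Matrix (Fin d) (Fin d) ℂ, (∀ j, IsDensity (σ j)) ∧ f = averageFidelity A σ}

/-- The constant
`F₂^iid = 2 (d² + d + 1 + (d - 1) √(d + 1)) / (d (d + 1) (d + 2))`. -/
noncomputable def F2iid (d : ℕ) : ℝ :=
  2 * ((d : ℝ) ^ 2 + d + 1 + ((d : ℝ) - 1) * Real.sqrt ((d : ℝ) + 1)) /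
    ((d : ℝ) * ((d : ℝ) + 1) * ((d : ℝ) + 2))

end QMeas

namespace QMeas

open Matrix MeasureTheory
open scoped Kronecker ComplexOrder

/-! The third moment of a Haar random pure state is the symmetrizer on three copies divided by `d (d
+ 1) (d + 2)` (`integral_expectation_mul`), so the fidelity of a product POVM becomes a sum of the
six-term forms `symTrace`. For unit vectors with overlap `t`, the best estimator gives `2 (1 + t +
t²)` (`symTrace_ketbra_le`, `exists_symTrace_ketbra_eq`). Splitting every POVM element into spectral
projectors can only raise the optimum, and completeness fixes the weighted sums of `1` and `t²`;
what remains to bound is the weighted sum of `t`, the `totalOverlap`.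

Write `s = 1 / √(d + 1)`. The polynomial `overlapGap` is nonnegative on `[0, 1]`, vanishes there
only at `s` and `1`, and is linear in `1, t, t², t⁴`. The sum of `t⁴` is a constant plus the inner
product of the two deviations from a 2-design. This gives the identity `totalOverlap_add_gap`.

For `A ⊗ A` the inner product is a squared norm, so reaching `F2iid` forces a 2-design with all
overlaps `s` or `1`. Orthogonal eigenvectors of one element would have overlap `0`, hence a simple
`A` has rank one and equiangular vectors, and completeness makes it a SIC. For `A ⊗ B` the inner
product vanishes because the deviation of `A` does, so the overlaps between `A` and `B` are again
`s` or `1`. A vector with overlap `s` to all of `A` would contradict completeness, so every vector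
of `B` occurs in `A` up to phase, and counting finishes the argument. Conversely, a SIC attains the
value by direct computation. -/

instance isProbabilityMeasure_haarUnitary (d : ℕ) : IsProbabilityMeasure (haarUnitary d) :=
  ⟨by simpa [haarUnitary] using
    Measure.haarMeasure_self (K₀ := (⊤ : TopologicalSpace.PositiveCompacts (unitaryGroup (Fin d) ℂ)))⟩

instance isMulLeftInvariant_haarUnitary (d : ℕ) : (haarUnitary d).IsMulLeftInvariant := by
  unfold haarUnitary; infer_instance

lemma integrable_haarUnitary {d : ℕ} {f : unitaryGroup (Fin d) ℂ → ℝ} (hf : Continuous f) :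
    Integrable f (haarUnitary d) :=
  hf.integrable_of_hasCompactSupport (HasCompactSupport.of_compactSpace f)

@[fun_prop]
lemma continuous_entry {d : ℕ} (i j : Fin d) :
    Continuous fun U : unitaryGroup (Fin d) ℂ => (U : Matrix (Fin d) (Fin d) ℂ) i j :=
  (continuous_subtype_val (p := fun U => U ∈ unitaryGroup (Fin d) ℂ)).matrix_elem i j

/-! ### Third moments of the coordinate weights of a Haar random state. -/

section Weights

variable {d : ℕ} [NeZero d]

/-- The squared modulus of the `i`-th coordinate of the state vector `U |0⟩`. -/
noncomputable def weight (U : unitaryGroup (Fin d) ℂ) (i : Fin d) : ℝ :=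
  Complex.normSq ((U : Matrix (Fin d) (Fin d) ℂ) i 0)

@[fun_prop]
lemma continuous_weight (i : Fin d) :
    Continuous fun U : unitaryGroup (Fin d) ℂ => weight U i :=
  Complex.continuous_normSq.comp (continuous_entry i 0)

lemma sum_weight (U : unitaryGroup (Fin d) ℂ) : ∑ i, weight U i = 1 := by
  have h := congrFun (congrFun (mem_unitaryGroup_iff'.1 U.2) 0) 0
  simp only [mul_apply, star_apply, one_apply_eq] at h
  have h2 := congrArg Complex.re h
  simp only [Complex.re_sum, Complex.one_re] at h2
  rw [← h2]
  refine Finset.sum_congr rfl fun i _ => ?_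
  simp [weight, Complex.normSq_apply]

/-- Twice the real part of the coherence between the coordinates `i` and `j` of `U |0⟩`, the
latter with an additional phase `u`. -/
noncomputable def coherence (U : unitaryGroup (Fin d) ℂ) (i j : Fin d) (u : ℂ) : ℝ :=
  2 * ((U : Matrix (Fin d) (Fin d) ℂ) i 0 * star (u * (U : Matrix (Fin d) (Fin d) ℂ) j 0)).re

/-- The unitary is a Hadamard-type reflection in the plane of the coordinates `i` and `j`: it sends
`(x, y)` to `((x + u y) / √2, ū (x - u y) / √2)`. -/
lemma exists_rotation {i j : Fin d} (hij : i ≠ j) {u : ℂ} (hu : Complex.normSq u = 1) :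
    ∃ V : unitaryGroup (Fin d) ℂ, ∀ U : unitaryGroup (Fin d) ℂ,
      weight (V * U) i = (weight U i + weight U j + coherence U i j u) / 2 ∧
      weight (V * U) j = (weight U i + weight U j - coherence U i j u) / 2 ∧
      ∀ k, k ≠ i → k ≠ j → weight (V * U) k = weight U k := by
  have hu' : star u * u = 1 := by
    rw [mul_comm]; simpa [hu] using Complex.mul_conj u
  set r : ℝ := Real.sqrt 2 / 2 with hr
  have hrr : r * r = 1 / 2 := by
    have := Real.mul_self_sqrt (show (0 : ℝ) ≤ 2 by norm_num)
    rw [hr]; linarith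
  have hrc : (r : ℂ) * r = 1 / 2 := by
    rw [← Complex.ofReal_mul, hrr]; norm_num
  -- `K` is twice a rank-one projector, so `1 - K` is a Hermitian involution and hence unitary.
  let K : Matrix (Fin d) (Fin d) ℂ := single i i (1 - (r : ℂ)) + single i j (-(r * u)) +
    single j i (-(r * star u)) + single j j (1 + (r : ℂ))
  have hKs : star K = K := by
    simp only [K, star_eq_conjTranspose, conjTranspose_add, conjTranspose_single]
    simp only [star_sub, star_add, star_neg, star_mul', star_one, Complex.star_def,
      Complex.conj_ofReal, Complex.conj_conj]
    abel
  have hKK : K * K = K + K := by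
    have e1 : (1 - (r : ℂ)) * (1 - r) + -(r * u) * -(r * star u) = (1 - r) + (1 - r) := by
      linear_combination (1 + star u * u) * hrc + (1 / 2) * hu'
    have e2 : (1 - (r : ℂ)) * -(r * u) + -(r * u) * (1 + r) = -(r * u) + -(r * u) := by ring
    have e3 : -(r * star u) * (1 - (r : ℂ)) + (1 + r) * -(r * star u) =
      -(r * star u) + -(r * star u) := by ring
    have e4 : -(r * star u) * -((r : ℂ) * u) + (1 + (r : ℂ)) * (1 + r) = (1 + r) + (1 + r) := by
      linear_combination (1 + star u * u) * hrc + (1 / 2) * hu'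
    have e : K + K = single i i ((1 - (r : ℂ)) + (1 - r)) + single i j (-(r * u) + -(r * u)) +
        single j i (-(r * star u) + -(r * star u)) + single j j ((1 + (r : ℂ)) + (1 + r)) := by
      simp only [single_add, K]; abel
    rw [e, ← e1, ← e2, ← e3, ← e4]
    simp only [K, mul_add, add_mul, single_mul_single_same, single_mul_single_of_ne _ _ _ _ hij,
      single_mul_single_of_ne _ _ _ _ hij.symm, add_zero, zero_add, single_add]
    abel
  have hV : 1 - K ∈ unitaryGroup (Fin d) ℂ := by
    rw [mem_unitaryGroup_iff, star_sub, hKs, star_one, sub_mul, mul_sub, mul_sub, hKK]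
    simp
  have hentry (U : unitaryGroup (Fin d) ℂ) (k : Fin d) :
      ((⟨1 - K, hV⟩ * U : unitaryGroup (Fin d) ℂ) : Matrix (Fin d) (Fin d) ℂ) k 0 =
        (U : Matrix (Fin d) (Fin d) ℂ) k 0 - (K * (U : Matrix (Fin d) (Fin d) ℂ)) k 0 := by
    simp [sub_mul]
  refine ⟨⟨1 - K, hV⟩, fun U => ?_⟩
  simp only [weight, hentry, coherence]
  set x := (U : Matrix (Fin d) (Fin d) ℂ) i 0
  set y := (U : Matrix (Fin d) (Fin d) ℂ) j 0
  have hi : (K * (U : Matrix (Fin d) (Fin d) ℂ)) i 0 = (1 - r) * x - r * (u * y) := by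
    simp [K, add_mul, hij, x, y]; ring
  have hj : (K * (U : Matrix (Fin d) (Fin d) ℂ)) j 0 = (1 + r) * y - r * (star u * x) := by
    simp [K, add_mul, hij.symm, x, y]; ring
  have hy : y = star u * (u * y) := by rw [← mul_assoc, hu', one_mul]
  have hn (z : ℂ) : Complex.normSq (r * z) = Complex.normSq z / 2 := by
    rw [Complex.normSq_mul, Complex.normSq_ofReal, hrr]; ring
  have hny : Complex.normSq y = Complex.normSq (u * y) := by rw [Complex.normSq_mul, hu, one_mul]
  refine ⟨?_, ?_, fun k hki hkj => ?_⟩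
  · have : x - ((1 - r) * x - r * (u * y)) = r * (x + u * y) := by ring
    rw [hi, this, hn, Complex.normSq_add, hny]; simp
  · have : y - ((1 + r) * y - r * (star u * x)) = r * (star u * (x - u * y)) := by
      linear_combination (r : ℂ) * y * hu'
    rw [hj, this, hn, Complex.normSq_mul, Complex.star_def, Complex.normSq_conj, hu, one_mul,
      Complex.normSq_sub, hny]
  · simp [K, add_mul, hki, hkj]

lemma coherence_neg (U : unitaryGroup (Fin d) ℂ) (i j : Fin d) (u : ℂ) :
    coherence U i j (-u) = - coherence U i j u := by
  simp [coherence]; ring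

/-- Coherences are not functions of the weights, but the squares at phases `1` and `i` add up to
one. For polynomials of degree at most three, averaging over `±1, ±i` therefore leaves only weights.
-/
lemma coherence_sq_add (U : unitaryGroup (Fin d) ℂ) (i j : Fin d) :
    coherence U i j 1 ^ 2 + coherence U i j Complex.I ^ 2 = 4 * (weight U i * weight U j) := by
  simp [coherence, weight, Complex.normSq_apply]; ring

@[fun_prop]
lemma continuous_coherence (i j : Fin d) (u : ℂ) :
    Continuous fun U : unitaryGroup (Fin d) ℂ => coherence U i j u := by
  unfold coherence
  exact continuous_const.mul (Complex.continuous_re.comp (by fun_prop))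

omit [NeZero d] in
lemma integral_add_four {f₁ f₂ f₃ f₄ : unitaryGroup (Fin d) ℂ → ℝ}
    (h₁ : Integrable f₁ (haarUnitary d)) (h₂ : Integrable f₂ (haarUnitary d))
    (h₃ : Integrable f₃ (haarUnitary d)) (h₄ : Integrable f₄ (haarUnitary d)) :
    ∫ U, f₁ U ∂(haarUnitary d) + ∫ U, f₂ U ∂(haarUnitary d) + ∫ U, f₃ U ∂(haarUnitary d) +
      ∫ U, f₄ U ∂(haarUnitary d) = ∫ U, (f₁ U + f₂ U + f₃ U + f₄ U) ∂(haarUnitary d) := by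
  rw [integral_add (f := fun U => f₁ U + f₂ U + f₃ U) ((h₁.add h₂).add h₃) h₄,
    integral_add (f := fun U => f₁ U + f₂ U) (h₁.add h₂) h₃, integral_add h₁ h₂]

/-- Averaging over the four rotations with phases `±1, ±i`. -/
lemma integral_weight_average {i j : Fin d} (hij : i ≠ j) (F : ℝ → ℝ → (Fin d → ℝ) → ℝ)
    (hF : Continuous fun x : ℝ × ℝ × (Fin d → ℝ) => F x.1 x.2.1 x.2.2)
    (G : unitaryGroup (Fin d) ℂ → ℝ)
    (hFk : ∀ x y p q, (∀ k, k ≠ i → k ≠ j → p k = q k) → F x y p = F x y q)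
    (hG : ∀ U, ∀ c s : ℝ, c ^ 2 + s ^ 2 = 4 * (weight U i * weight U j) →
      F ((weight U i + weight U j + c) / 2) ((weight U i + weight U j - c) / 2) (weight U) +
      F ((weight U i + weight U j - c) / 2) ((weight U i + weight U j + c) / 2) (weight U) +
      F ((weight U i + weight U j + s) / 2) ((weight U i + weight U j - s) / 2) (weight U) +
      F ((weight U i + weight U j - s) / 2) ((weight U i + weight U j + s) / 2) (weight U) =
        4 * G U) :
    ∫ U, F (weight U i) (weight U j) (weight U) ∂(haarUnitary d) = ∫ U, G U ∂(haarUnitary d) := by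
  have hw : Continuous fun U : unitaryGroup (Fin d) ℂ => weight U := by fun_prop
  -- Left invariance of the Haar measure inserts the rotation; the third argument of `F` may stay
  -- unrotated by `hFk`.
  have key (u : ℂ) (hu : Complex.normSq u = 1) :
      ∫ U, F (weight U i) (weight U j) (weight U) ∂(haarUnitary d) =
      ∫ U, F ((weight U i + weight U j + coherence U i j u) / 2)
        ((weight U i + weight U j - coherence U i j u) / 2) (weight U) ∂(haarUnitary d) := by
    obtain ⟨V, hV⟩ := exists_rotation hij hu
    rw [← integral_mul_left_eq_self _ V]
    refine integral_congr_ae (.of_forall fun U => ?_)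
    obtain ⟨h1, h2, h3⟩ := hV U
    simp only [h1, h2]
    exact hFk _ _ _ _ h3
  have hint (u : ℂ) : Integrable (fun U => F ((weight U i + weight U j + coherence U i j u) / 2)
        ((weight U i + weight U j - coherence U i j u) / 2) (weight U)) (haarUnitary d) :=
    integrable_haarUnitary (hF.comp (g := fun x : ℝ × ℝ × (Fin d → ℝ) => F x.1 x.2.1 x.2.2)
      (f := fun U => ((weight U i + weight U j + coherence U i j u) / 2,
        (weight U i + weight U j - coherence U i j u) / 2, weight U)) (by fun_prop))
  have h4 : 4 * ∫ U, F (weight U i) (weight U j) (weight U) ∂(haarUnitary d) =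
      ∫ U, 4 * G U ∂(haarUnitary d) := by
    have : ∀ x : ℝ, 4 * x = x + x + x + x := fun x => by ring
    rw [this]
    nth_rw 1 [key 1 (by simp)]
    nth_rw 1 [key (-1) (by simp)]
    nth_rw 1 [key Complex.I (by simp)]
    nth_rw 1 [key (-Complex.I) (by simp)]
    rw [integral_add_four (hint _) (hint _) (hint _) (hint _)]
    refine integral_congr_ae (.of_forall fun U => ?_)
    simp only [coherence_neg, ← sub_eq_add_neg, sub_neg_eq_add]
    exact hG U _ _ (coherence_sq_add U i j)
  rw [integral_const_mul] at h4
  linarith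

/-- The third moments of the weights of a Haar random state. -/
noncomputable def moment (i j k : Fin d) : ℝ :=
  ∫ U, weight U i * weight U j * weight U k ∂(haarUnitary d)

lemma moment_rotate (i j k : Fin d) : moment i j k = moment j k i := by
  unfold moment
  congr 1; ext U; ring

lemma moment_iik {i j k : Fin d} (hij : i ≠ j) (hki : k ≠ i) (hkj : k ≠ j) :
    4 * moment i i k = moment i i k + moment j j k + 4 * moment i j k := by
  have h := integral_weight_average hij (fun x _ p => x * x * p k) (by fun_prop)
    (fun U => 1 / 4 * (weight U i * weight U i * weight U k + weight U j * weight U j * weight U k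
      + 4 * (weight U i * weight U j * weight U k)))
    (fun x y p q h => by simp only [h k hki hkj])
    (fun U c s h => by linear_combination (1 / 2) * weight U k * h)
  rw [integral_const_mul, integral_add (integrable_haarUnitary (by fun_prop))
    (integrable_haarUnitary (by fun_prop)), integral_add (integrable_haarUnitary (by fun_prop))
    (integrable_haarUnitary (by fun_prop)), integral_const_mul] at h
  simp only [moment]; linarith

lemma moment_iii {i j : Fin d} (hij : i ≠ j) :
    8 * moment i i i = moment i i i + moment j j j + 9 * (moment i i j + moment i j j) := by
  have h := integral_weight_average hij (fun x _ _ => x * x * x) (by fun_prop)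
    (fun U => 1 / 8 * (weight U i * weight U i * weight U i + weight U j * weight U j * weight U j
      + 9 * (weight U i * weight U i * weight U j + weight U i * weight U j * weight U j)))
    (fun x y p q h => rfl)
    (fun U c s h => by linear_combination (3 / 4) * (weight U i + weight U j) * h)
  rw [integral_const_mul, integral_add (integrable_haarUnitary (by fun_prop))
    (integrable_haarUnitary (by fun_prop)), integral_add (integrable_haarUnitary (by fun_prop))
    (integrable_haarUnitary (by fun_prop)), integral_const_mul,
    integral_add (integrable_haarUnitary (by fun_prop))
    (integrable_haarUnitary (by fun_prop))] at h
  simp only [moment]; linarith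

lemma moment_iij {i j : Fin d} (hij : i ≠ j) : moment i i j = moment i j j := by
  have h := integral_weight_average hij (fun x y _ => x * x * y) (by fun_prop)
    (fun U => 1 / 8 * ((weight U i + weight U j) ^ 3 - 2 * (weight U i + weight U j) *
      (weight U i * weight U j)))
    (fun x y p q h => rfl)
    (fun U c s h => by linear_combination (-1 / 4) * (weight U i + weight U j) * h)
  have h' := integral_weight_average hij (fun x y _ => x * y * y) (by fun_prop)
    (fun U => 1 / 8 * ((weight U i + weight U j) ^ 3 - 2 * (weight U i + weight U j) *
      (weight U i * weight U j)))
    (fun x y p q h => rfl)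
    (fun U c s h => by linear_combination (-1 / 4) * (weight U i + weight U j) * h)
  exact h.trans h'.symm

/-- The factor counts the permutations fixing the triple `(i, j, k)`: 6, 2 or 1. The rotation
identities force moments of patterns `iii`, `iij`, `ijk` to be in this ratio, independently of the
indices. -/
lemma moment_eq_aux {i j k : Fin d} : moment i j k = moment (0 : Fin d) 0 0 / 6 *
    ((1 + (if i = j then 1 else 0)) * (1 + (if i = k then 1 else 0) + if j = k then 1 else 0)) := by
  have h3 {i j : Fin d} (hij : i ≠ j) : moment i i i = 3 * moment i i j ∧
      moment j j j = moment i i i := by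
    have a := moment_iii hij
    have b := moment_iii hij.symm
    have c := moment_iij hij
    have e := moment_iij hij.symm
    have f := moment_rotate i j j
    constructor <;> linarith
  have hd (i : Fin d) : moment i i i = moment (0 : Fin d) 0 0 := by
    by_cases h : i = 0
    · rw [h]
    · exact (h3 (Ne.symm h)).2
  have hiij {i j : Fin d} (hij : i ≠ j) : moment i i j = moment (0 : Fin d) 0 0 / 3 := by
    have := (h3 hij).1
    rw [hd] at this; linarith
  by_cases hij : i = j
  · subst hij
    by_cases hik : i = k
    · subst hik; simp [hd]; ring
    · simp [hik, hiij hik]; ring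
  · by_cases hik : i = k
    · subst hik
      rw [moment_rotate, moment_rotate, hiij hij]
      simp [hij, Ne.symm hij]; ring
    · by_cases hjk : j = k
      · subst hjk
        rw [moment_rotate, hiij (Ne.symm hij)]
        simp [hij]; ring
      · have := moment_iik hij (Ne.symm hik) (Ne.symm hjk)
        rw [hiij hik, hiij hjk] at this
        simp [hij, hik, hjk]; linarith

omit [NeZero d] in
-- The six permutations sorted by cycle type: one identity, three transpositions, two 3-cycles.
lemma sum_pairing_factor (l : Fin d → ℝ) :
    ∑ i, ∑ j, ∑ k, l i * l j * l k * ((1 + (if i = j then 1 else 0)) *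
      (1 + (if i = k then 1 else 0) + if j = k then 1 else 0)) =
    (∑ i, l i) ^ 3 + 3 * (∑ i, l i) * (∑ i, l i ^ 2) + 2 * ∑ i, l i ^ 3 := by
  have h (i j k : Fin d) : l i * l j * l k * ((1 + (if i = j then 1 else 0)) *
      (1 + (if i = k then 1 else 0) + if j = k then 1 else 0)) = l i * (l j * l k) +
        l i * ((if i = k then l k else 0) * l j) + l i * (l j * (if j = k then l k else 0)) +
        l i * ((if i = j then l j else 0) * l k) +
        l i * ((if i = j then l j else 0) * (if i = k then l k else 0)) +
        l i * ((if i = j then l j else 0) * (if i = k then l k else 0)) := by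
    rcases eq_or_ne i j with rfl | hij
    · split_ifs <;> ring
    · simp only [if_neg hij]
      split_ifs <;> ring
  have h3 : ∑ i, l i * (l i * l i) = ∑ i, l i ^ 3 := by simp only [pow_three]
  simp only [h, Finset.sum_add_distrib, ← Finset.mul_sum, ← Finset.sum_mul, Finset.sum_ite_eq,
    Finset.mem_univ, if_true]
  simp only [h3]
  simp only [← mul_assoc, ← Finset.sum_mul, ← pow_two]
  ring

lemma moment_eq (i j k : Fin d) : moment i j k = 1 / (d * (d + 1) * (d + 2)) *
    ((1 + (if i = j then 1 else 0)) * (1 + (if i = k then 1 else 0) + if j = k then 1 else 0)) := by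
  -- The weights sum to one, which fixes the remaining common constant.
  have hs : ∑ i : Fin d, ∑ j : Fin d, ∑ k : Fin d, moment i j k = 1 := by
    have (U : unitaryGroup (Fin d) ℂ) :
        ∑ i, ∑ j, ∑ k, weight U i * weight U j * weight U k = 1 := by
      simp only [← Finset.mul_sum, sum_weight, mul_one]
    have h1 : ∫ U : unitaryGroup (Fin d) ℂ, ∑ i, ∑ j, ∑ k, weight U i * weight U j * weight U k
        ∂(haarUnitary d) = 1 := by
      simp only [this]; simp
    rw [← h1, integral_finsetSum _ fun i _ => integrable_haarUnitary (by fun_prop)]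
    refine Finset.sum_congr rfl fun i _ => ?_
    rw [integral_finsetSum _ fun i _ => integrable_haarUnitary (by fun_prop)]
    refine Finset.sum_congr rfl fun j _ => ?_
    rw [integral_finsetSum _ fun i _ => integrable_haarUnitary (by fun_prop)]
    rfl
  have hd : (0 : ℝ) < d := by exact_mod_cast NeZero.pos d
  have h6 : moment (0 : Fin d) 0 0 / 6 = 1 / (d * (d + 1) * (d + 2)) := by
    rw [eq_div_iff (by positivity)]
    refine Eq.trans ?_ hs
    rw [Finset.sum_congr rfl fun i _ => Finset.sum_congr rfl fun j _ => Finset.sum_congr rfl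
      fun k _ => moment_eq_aux (i := i) (j := j) (k := k)]
    simp only [← Finset.mul_sum]
    have := sum_pairing_factor fun _ : Fin d => 1
    simp only [one_mul, one_pow, Finset.sum_const, Finset.card_univ, Fintype.card_fin,
      nsmul_eq_mul, mul_one, ← Finset.mul_sum] at this
    rw [this]
    ring
  rw [moment_eq_aux, h6]

lemma integral_sum_weight_pow (l : Fin d → ℝ) :
    ∫ U, (∑ i, l i * weight U i) ^ 3 ∂(haarUnitary d) = 1 / (d * (d + 1) * (d + 2)) *
      ((∑ i, l i) ^ 3 + 3 * (∑ i, l i) * (∑ i, l i ^ 2) + 2 * ∑ i, l i ^ 3) := by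
  have h1 : ∫ U, (∑ i, l i * weight U i) ^ 3 ∂(haarUnitary d) =
      ∑ i, ∑ j, ∑ k, l i * l j * l k * moment i j k := by
    have (U : unitaryGroup (Fin d) ℂ) : (∑ i, l i * weight U i) ^ 3 =
        ∑ i, ∑ j, ∑ k, l i * l j * l k * (weight U i * weight U j * weight U k) := by
      rw [pow_three, Finset.sum_mul_sum, Finset.sum_mul_sum]
      refine Finset.sum_congr rfl fun i _ => Finset.sum_congr rfl fun j _ => ?_
      rw [Finset.mul_sum]
      refine Finset.sum_congr rfl fun k _ => by ring
    simp only [this]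
    rw [integral_finsetSum _ fun i _ => integrable_haarUnitary (by fun_prop)]
    refine Finset.sum_congr rfl fun i _ => ?_
    rw [integral_finsetSum _ fun i _ => integrable_haarUnitary (by fun_prop)]
    refine Finset.sum_congr rfl fun j _ => ?_
    rw [integral_finsetSum _ fun i _ => integrable_haarUnitary (by fun_prop)]
    refine Finset.sum_congr rfl fun k _ => ?_
    rw [integral_const_mul, moment]
  rw [h1, ← sum_pairing_factor, Finset.mul_sum]
  simp only [moment_eq, Finset.mul_sum]
  refine Finset.sum_congr rfl fun i _ => Finset.sum_congr rfl fun j _ =>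
    Finset.sum_congr rfl fun k _ => by ring

end Weights

/-! ### The third moment operator and the fidelity of product measurements. -/

/-- The sum over all permutations of three factors of the trace of the permutation operator times
`A ⊗ B ⊗ C`. -/
def symTrace {n : Type*} [Fintype n] (A B C : Matrix n n ℂ) : ℂ :=
  A.trace * B.trace * C.trace + (A * B).trace * C.trace + (A * C).trace * B.trace +
    (B * C).trace * A.trace + (A * B * C).trace + (B * A * C).trace

/-- `symTrace` is trilinear and, by cyclicity of the trace, symmetric. Hence its diagonal values
determine it, and only cubes of a single Hermitian operator have to be integrated. -/
lemma symTrace_polarization {n : Type*} [Fintype n] (A B C : Matrix n n ℂ) :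
    6 * symTrace A B C = symTrace (A + B + C) (A + B + C) (A + B + C) -
      symTrace (A + B) (A + B) (A + B) - symTrace (A + C) (A + C) (A + C) -
      symTrace (B + C) (B + C) (B + C) + symTrace A A A + symTrace B B B + symTrace C C C := by
  have h1 : (B * A).trace = (A * B).trace := trace_mul_comm _ _
  have h2 : (C * A).trace = (A * C).trace := trace_mul_comm _ _
  have h3 : (C * B).trace = (B * C).trace := trace_mul_comm _ _
  have h4 : (B * (C * A)).trace = (A * (B * C)).trace := by
    rw [← mul_assoc, trace_mul_comm]
  have h5 : (C * (A * B)).trace = (A * (B * C)).trace := by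
    rw [trace_mul_comm, mul_assoc]
  have h6 : (C * (B * A)).trace = (B * (A * C)).trace := by
    rw [trace_mul_comm, mul_assoc]
  have h7 : (A * (C * B)).trace = (B * (A * C)).trace := by
    rw [← mul_assoc, trace_mul_comm]
  simp only [symTrace, mul_add, add_mul, trace_add, mul_assoc, h1, h2, h3, h4, h5, h6, h7]
  ring

section Expectation

variable {d : ℕ} [NeZero d]

/-- The probability weight `tr (ρ A)` of an operator in the state `ρ = U |0⟩⟨0| U†`. -/
noncomputable def expectation (U : unitaryGroup (Fin d) ℂ) (A : Matrix (Fin d) (Fin d) ℂ) : ℝ :=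
  (pureState U * A).trace.re

lemma expectation_add (U : unitaryGroup (Fin d) ℂ) (A B : Matrix (Fin d) (Fin d) ℂ) :
    expectation U (A + B) = expectation U A + expectation U B := by
  simp [expectation, mul_add]

@[fun_prop]
lemma continuous_expectation (A : Matrix (Fin d) (Fin d) ℂ) :
    Continuous fun U => expectation U A := by
  have h : Continuous fun U : unitaryGroup (Fin d) ℂ => (U : Matrix (Fin d) (Fin d) ℂ) :=
    continuous_subtype_val
  unfold expectation pureState
  exact Complex.continuous_re.comp (by fun_prop)

lemma isHermitian_pureState (U : unitaryGroup (Fin d) ℂ) : (pureState U).IsHermitian := by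
  simp [IsHermitian, pureState, conjTranspose_mul, mul_assoc]

lemma trace_mul_im_eq_zero {n : Type*} [Fintype n] {A B : Matrix n n ℂ} (hA : A.IsHermitian)
    (hB : B.IsHermitian) : (A * B).trace.im = 0 := by
  rw [← Complex.conj_eq_iff_im, ← Complex.star_def, ← trace_conjTranspose, conjTranspose_mul,
    hA.eq, hB.eq, trace_mul_comm]

lemma trace_pureState_mul_diagonal (U : unitaryGroup (Fin d) ℂ) (l : Fin d → ℝ) :
    (pureState U * diagonal (fun i => (l i : ℂ))).trace = ∑ i, ((l i * weight U i : ℝ) : ℂ) := by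
  have h (i : Fin d) : pureState U i i = (weight U i : ℂ) := by
    simp [pureState, weight, mul_apply, single_apply, Complex.mul_conj, ite_and]
  simp only [trace, diag_apply, mul_diagonal, h]
  refine Finset.sum_congr rfl fun i _ => by push_cast; ring

lemma integral_expectation_pow {A : Matrix (Fin d) (Fin d) ℂ} (hA : A.IsHermitian) :
    ((∫ U, expectation U A ^ 3 ∂(haarUnitary d) : ℝ) : ℂ) =
      1 / (d * (d + 1) * (d + 2)) * symTrace A A A := by
  set V := hA.eigenvectorUnitary
  set l := hA.eigenvalues
  set D : Matrix (Fin d) (Fin d) ℂ := diagonal (fun i => (l i : ℂ)) with hD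
  have hAV : A = (V : Matrix (Fin d) (Fin d) ℂ) * D * (V : Matrix (Fin d) (Fin d) ℂ)ᴴ := by
    conv_lhs => rw [hA.spectral_theorem]
    rfl
  have hVV : (V : Matrix (Fin d) (Fin d) ℂ)ᴴ * (V : Matrix (Fin d) (Fin d) ℂ) = 1 :=
    mem_unitaryGroup_iff'.1 V.2
  have htr (M : Matrix (Fin d) (Fin d) ℂ) :
      ((V : Matrix (Fin d) (Fin d) ℂ) * M * (V : Matrix (Fin d) (Fin d) ℂ)ᴴ).trace = M.trace := by
    rw [trace_mul_cycle, hVV, one_mul]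
  have hmul (M N : Matrix (Fin d) (Fin d) ℂ) :
      ((V : Matrix (Fin d) (Fin d) ℂ) * M * (V : Matrix (Fin d) (Fin d) ℂ)ᴴ) *
      ((V : Matrix (Fin d) (Fin d) ℂ) * N * (V : Matrix (Fin d) (Fin d) ℂ)ᴴ) =
      (V : Matrix (Fin d) (Fin d) ℂ) * (M * N) * (V : Matrix (Fin d) (Fin d) ℂ)ᴴ := by
    calc _ = (V : Matrix (Fin d) (Fin d) ℂ) * M * ((V : Matrix (Fin d) (Fin d) ℂ)ᴴ *
        (V : Matrix (Fin d) (Fin d) ℂ)) * N * (V : Matrix (Fin d) (Fin d) ℂ)ᴴ := by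
          simp only [mul_assoc]
      _ = _ := by rw [hVV]; simp only [mul_assoc, mul_one]
  -- Left invariance absorbs the eigenvector unitary, reducing to the diagonal case.
  have hexp (U : unitaryGroup (Fin d) ℂ) : expectation (V * U) A = ∑ i, l i * weight U i := by
    have : (pureState (V * U) * A).trace = (pureState U * D).trace := by
      have hp : pureState (V * U) = (V : Matrix (Fin d) (Fin d) ℂ) * pureState U *
          (V : Matrix (Fin d) (Fin d) ℂ)ᴴ := by
        simp [pureState, mul_assoc, conjTranspose_mul]
      rw [hp, hAV, hmul, htr]
    rw [expectation, this, hD, trace_pureState_mul_diagonal, ← Complex.ofReal_sum,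
      Complex.ofReal_re]
  have hsym : symTrace A A A =
      (((∑ i, l i) ^ 3 + 3 * (∑ i, l i) * (∑ i, l i ^ 2) + 2 * ∑ i, l i ^ 3 : ℝ) : ℂ) := by
    rw [symTrace, hAV]
    simp only [hmul, htr, hD, diagonal_mul_diagonal, trace_diagonal]
    push_cast
    simp only [pow_two, pow_three, mul_assoc]
    ring
  rw [← integral_mul_left_eq_self _ V]
  simp only [hexp]
  rw [integral_sum_weight_pow, hsym]
  push_cast
  rfl

/-- The third moment of the projector onto a Haar random pure state. -/
lemma integral_expectation_mul {A B C : Matrix (Fin d) (Fin d) ℂ} (hA : A.IsHermitian)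
    (hB : B.IsHermitian) (hC : C.IsHermitian) :
    ((∫ U, expectation U A * expectation U B * expectation U C ∂(haarUnitary d) : ℝ) : ℂ) =
      1 / (d * (d + 1) * (d + 2)) * symTrace A B C := by
  have key : 6 * ∫ U, expectation U A * expectation U B * expectation U C ∂(haarUnitary d) =
      ∫ U, expectation U (A + B + C) ^ 3 ∂(haarUnitary d) -
      ∫ U, expectation U (A + B) ^ 3 ∂(haarUnitary d) -
      ∫ U, expectation U (A + C) ^ 3 ∂(haarUnitary d) -
      ∫ U, expectation U (B + C) ^ 3 ∂(haarUnitary d) +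
      ∫ U, expectation U A ^ 3 ∂(haarUnitary d) +
      ∫ U, expectation U B ^ 3 ∂(haarUnitary d) +
      ∫ U, expectation U C ^ 3 ∂(haarUnitary d) := by
    have hi (M : Matrix (Fin d) (Fin d) ℂ) :
        Integrable (fun U => expectation U M ^ 3) (haarUnitary d) :=
      integrable_haarUnitary (by fun_prop)
    rw [← integral_const_mul, ← integral_sub (hi _) (hi _), ← integral_sub (by fun_prop) (hi _),
      ← integral_sub (by fun_prop) (hi _), ← integral_add (by fun_prop) (hi _),
      ← integral_add (by fun_prop) (hi _), ← integral_add (by fun_prop) (hi _)]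
    refine integral_congr_ae (.of_forall fun U => ?_)
    simp only [expectation_add]
    ring
  have key2 := congrArg Complex.ofReal key
  push_cast [integral_expectation_pow, hA, hB, hC, hA.add hB, hA.add hC, hB.add hC,
    (hA.add hB).add hC] at key2
  have hp := symTrace_polarization A B C
  generalize (∫ U, expectation U A * expectation U B * expectation U C ∂(haarUnitary d)) = x at *
  linear_combination (1 / 6) * key2 - (1 / 6) * (1 / (d * (d + 1) * (d + 2))) * hp

omit [NeZero d] in
lemma trace_tensorPow_mul_prod {ι κ : Type*} [Fintype ι] [Fintype κ] (A : POVM (Fin d) ι)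
    (B : POVM (Fin d) κ) (ρ : Matrix (Fin d) (Fin d) ℂ) (p : ι × κ) :
    (tensorPow 2 ρ * (A.prod B).elem p).trace =
      (ρ * A.elem p.1).trace * (ρ * B.elem p.2).trace := by
  have h : (tensorPow 2 ρ * (A.prod B).elem p).trace =
      ((ρ * A.elem p.1) ⊗ₖ (ρ * B.elem p.2)).trace := by
    rw [mul_kronecker_mul]
    simp only [trace, diag_apply, mul_apply]
    refine Fintype.sum_equiv (finTwoArrowEquiv (Fin d)) _ _ fun x => ?_
    refine Fintype.sum_equiv (finTwoArrowEquiv (Fin d)) _ _ fun y => ?_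
    simp [tensorPow, POVM.prod, Fin.prod_univ_two, kroneckerMap_apply]
  rw [h, trace_kronecker]

lemma averageFidelity_prod {ι κ : Type*} [Fintype ι] [Fintype κ] (A : POVM (Fin d) ι)
    (B : POVM (Fin d) κ) {σ : ι × κ → Matrix (Fin d) (Fin d) ℂ} (hσ : ∀ p, (σ p).IsHermitian) :
    averageFidelity (A.prod B) σ = 1 / (d * (d + 1) * (d + 2)) *
      ∑ p, (symTrace (A.elem p.1) (B.elem p.2) (σ p)).re := by
  rw [averageFidelity, Finset.mul_sum]
  refine Finset.sum_congr rfl fun p _ => ?_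
  have hA := (A.posSemidef p.1).isHermitian
  have hB := (B.posSemidef p.2).isHermitian
  have h := congrArg Complex.re (integral_expectation_mul hA hB (hσ p))
  have hr : (1 / ((d : ℂ) * (d + 1) * (d + 2))) = ((1 / (d * (d + 1) * (d + 2)) : ℝ) : ℂ) := by
    push_cast; rfl
  rw [Complex.ofReal_re, hr, Complex.re_ofReal_mul] at h
  rw [← h]
  congr 1
  ext U
  simp only [trace_tensorPow_mul_prod, Complex.mul_re, expectation,
    trace_mul_im_eq_zero (isHermitian_pureState U) hA]
  ring

end Expectation

/-! ### Optimal estimators for a pair of rank-one outcomes. -/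

section RankOne

variable {n : Type*} [Fintype n]

/-- The rank-one operator `|v⟩⟨v|`. -/
def ketbra (v : n → ℂ) : Matrix n n ℂ := vecMulVec v (star v)

/-- The overlap `|⟨v|w⟩|`. -/
noncomputable def overlap (v w : n → ℂ) : ℝ := ‖star v ⬝ᵥ w‖

lemma overlap_nonneg (v w : n → ℂ) : 0 ≤ overlap v w := norm_nonneg _

lemma overlap_comm (v w : n → ℂ) : overlap v w = overlap w v := by
  rw [overlap, overlap, ← norm_star, star_dotProduct, star_star, dotProduct_comm]

lemma posSemidef_ketbra (v : n → ℂ) : (ketbra v).PosSemidef := posSemidef_vecMulVec_self_star v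

lemma ketbra_mul_ketbra (v w : n → ℂ) :
    ketbra v * ketbra w = (star v ⬝ᵥ w) • vecMulVec v (star w) := by
  rw [ketbra, ketbra, vecMulVec_mul_vecMulVec, vecMulVec_smul]

lemma trace_ketbra (v : n → ℂ) : (ketbra v).trace = star v ⬝ᵥ v := by
  rw [ketbra, trace_vecMulVec, dotProduct_comm]

lemma trace_ketbra_mul (v : n → ℂ) (M : Matrix n n ℂ) :
    (ketbra v * M).trace = star v ⬝ᵥ M *ᵥ v := by
  rw [trace_mul_comm, ketbra, mul_vecMulVec, trace_vecMulVec, dotProduct_comm]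

lemma trace_ketbra_mul_ketbra (v w : n → ℂ) :
    (ketbra v * ketbra w).trace = ((overlap v w ^ 2 : ℝ) : ℂ) := by
  have h : star w ⬝ᵥ v = star (star v ⬝ᵥ w) := by
    rw [star_dotProduct]
  rw [ketbra_mul_ketbra, trace_smul, trace_vecMulVec, dotProduct_comm v, h, overlap, smul_eq_mul,
    Complex.star_def, Complex.mul_conj, Complex.normSq_eq_norm_sq]

lemma ketbra_smul {u : ℂ} (hu : ‖u‖ = 1) (v : n → ℂ) : ketbra (u • v) = ketbra v := by
  have : u * star u = 1 := by
    rw [Complex.star_def, Complex.mul_conj, Complex.normSq_eq_norm_sq, hu]; simp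
  rw [ketbra, star_smul, smul_vecMulVec, vecMulVec_smul, smul_smul, this, one_smul, ketbra]

/-- Two vectors can be aligned by a phase. -/
lemma exists_phase_dotProduct (v w : n → ℂ) :
    ∃ u : ℂ, ‖u‖ = 1 ∧ star v ⬝ᵥ (u • w) = (overlap v w : ℂ) := by
  by_cases h : star v ⬝ᵥ w = 0
  · exact ⟨1, by simp, by simp [overlap, h]⟩
  · have hn : (‖star v ⬝ᵥ w‖ : ℂ) ≠ 0 := by simpa using h
    refine ⟨star (star v ⬝ᵥ w) / ‖star v ⬝ᵥ w‖, ?_, ?_⟩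
    · rw [norm_div, norm_star, Complex.norm_real, norm_norm, div_self (by simpa using h)]
    · rw [dotProduct_smul, smul_eq_mul, div_mul_eq_mul_div, div_eq_iff hn, overlap, mul_comm,
        Complex.star_def, Complex.mul_conj, Complex.normSq_eq_norm_sq]
      push_cast; ring

variable {v w : n → ℂ}

lemma overlap_self (hv : star v ⬝ᵥ v = 1) : overlap v v = 1 := by simp [overlap, hv]

/-- The squared Hilbert–Schmidt distance yields both the bound `overlap ≤ 1` and its equality case.
-/
lemma trace_ketbra_sub_sq (hv : star v ⬝ᵥ v = 1) (hw : star w ⬝ᵥ w = 1) :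
    ((ketbra v - ketbra w)ᴴ * (ketbra v - ketbra w)).trace =
      ((2 - 2 * overlap v w ^ 2 : ℝ) : ℂ) := by
  rw [conjTranspose_sub, (posSemidef_ketbra v).isHermitian.eq,
    (posSemidef_ketbra w).isHermitian.eq, mul_sub, sub_mul, sub_mul, trace_sub, trace_sub,
    trace_sub]
  simp only [trace_ketbra_mul_ketbra, overlap_self hv, overlap_self hw, overlap_comm w v]
  push_cast; ring

lemma overlap_le_one (hv : star v ⬝ᵥ v = 1) (hw : star w ⬝ᵥ w = 1) : overlap v w ≤ 1 := by
  have h := (posSemidef_conjTranspose_mul_self (ketbra v - ketbra w)).trace_nonneg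
  rw [trace_ketbra_sub_sq hv hw, Complex.zero_le_real] at h
  nlinarith [overlap_nonneg v w]

lemma ketbra_eq_of_overlap_eq_one (hv : star v ⬝ᵥ v = 1) (hw : star w ⬝ᵥ w = 1)
    (h : overlap v w = 1) : ketbra v = ketbra w := by
  have h' := trace_ketbra_sub_sq hv hw
  rw [h] at h'
  norm_num at h'
  rw [← sub_eq_zero]
  exact trace_conjTranspose_mul_self_eq_zero_iff.1 (by simpa using h')

lemma ketbra_mul_self (hv : star v ⬝ᵥ v = 1) : ketbra v * ketbra v = ketbra v := by
  rw [ketbra_mul_ketbra, hv, one_smul, ketbra]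

lemma symTrace_ketbra (hv : star v ⬝ᵥ v = 1) (hw : star w ⬝ᵥ w = 1) (σ : Matrix n n ℂ) :
    symTrace (ketbra v) (ketbra w) σ = (1 + (overlap v w ^ 2 : ℝ)) * σ.trace +
      ((ketbra v + ketbra w) * (ketbra v + ketbra w) * σ).trace := by
  simp only [symTrace, trace_ketbra_mul_ketbra, trace_ketbra, hv, hw, mul_add, add_mul, trace_add,
    ketbra_mul_self hv, ketbra_mul_self hw, one_mul]
  ring

lemma trace_ketbra_mul_nonneg (v : n → ℂ) {σ : Matrix n n ℂ} (hσ : σ.PosSemidef) :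
    0 ≤ (ketbra v * σ).trace.re := by
  rw [trace_ketbra_mul]
  exact hσ.re_dotProduct_nonneg v

lemma trace_mul_mul_nonneg {N σ : Matrix n n ℂ} (hN : N.IsHermitian) (hσ : σ.PosSemidef) :
    0 ≤ (N * N * σ).trace.re := by
  have h := (hσ.mul_mul_conjTranspose_same N).trace_nonneg
  rw [hN.eq, trace_mul_cycle] at h
  exact (Complex.le_def.1 h).1

lemma ketbra_add_sq {t : ℝ} (hv : star v ⬝ᵥ v = 1) (hw : star w ⬝ᵥ w = 1)
    (ht : star v ⬝ᵥ w = t) : (ketbra v + ketbra w) * (ketbra v + ketbra w) =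
      ketbra v + ketbra w + (t : ℂ) • (vecMulVec v (star w) + vecMulVec w (star v)) := by
  have ht' : star w ⬝ᵥ v = t := by
    rw [star_dotProduct, ht, Complex.star_def, Complex.conj_ofReal]
  rw [mul_add, add_mul, add_mul, ketbra_mul_self hv, ketbra_mul_self hw, ketbra_mul_ketbra v w,
    ketbra_mul_ketbra w v, ht, ht', smul_add]
  abel

/-- After aligning phases, `M = |v⟩⟨v| + |x⟩⟨x|` has largest eigenvalue `1 + t`, so `tr (M² σ) ≤ (1
+ t)²`; the rest of `symTrace` is `1 + t²`. -/
lemma symTrace_ketbra_le (hv : star v ⬝ᵥ v = 1) (hw : star w ⬝ᵥ w = 1) {σ : Matrix n n ℂ}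
    (hσ : σ.PosSemidef) (hσ1 : σ.trace = 1) :
    (symTrace (ketbra v) (ketbra w) σ).re ≤ 2 * (1 + overlap v w + overlap v w ^ 2) := by
  classical
  obtain ⟨u, hu, huw⟩ := exists_phase_dotProduct v w
  have hw' : star (u • w) ⬝ᵥ (u • w) = 1 := by
    rw [← trace_ketbra, ketbra_smul hu, trace_ketbra, hw]
  rw [symTrace_ketbra hv hw, ← ketbra_smul hu w]
  set x := u • w
  set t := overlap v w
  have ht0 : 0 ≤ t := overlap_nonneg v w
  set M := ketbra v + ketbra x with hM
  have hMh : M.IsHermitian :=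
    (posSemidef_ketbra v).isHermitian.add (posSemidef_ketbra x).isHermitian
  have h1 := trace_ketbra_mul_nonneg (v - x) hσ
  -- Positivity of this operator gives `tr (M² σ) ≤ (1 + t) tr (M σ)`. Combined with `tr (((1 + t) -
  -- M)² σ) ≥ 0` it bounds `tr (M² σ)` without diagonalizing `M`.
  have e1 : (t : ℂ) • ketbra (v - x) = (1 + t : ℂ) • M - M * M := by
    rw [hM, ketbra_add_sq hv hw' huw, ← hM]
    simp only [ketbra, hM, star_sub, vecMulVec_sub, sub_vecMulVec]
    module
  have hN : ((1 + t : ℂ) • (1 : Matrix n n ℂ) - M).IsHermitian := by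
    refine IsHermitian.sub ?_ hMh
    simp [IsHermitian, conjTranspose_smul]
  have h2 := trace_mul_mul_nonneg hN hσ
  have e2 : ((1 + t : ℂ) • (1 : Matrix n n ℂ) - M) * ((1 + t : ℂ) • (1 : Matrix n n ℂ) - M) * σ =
      ((1 + t : ℂ) ^ 2) • σ - (2 * (1 + t : ℂ)) • (M * σ) + M * M * σ := by
    simp only [sub_mul, mul_sub, smul_mul_assoc, mul_smul_comm, one_mul, mul_one]
    module
  have h3 := congrArg (fun N => (N * σ).trace.re) e1
  simp only [sub_mul, smul_mul_assoc, trace_sub, trace_smul, smul_eq_mul, Complex.sub_re,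
    Complex.re_ofReal_mul] at h3
  rw [e2] at h2
  simp only [trace_sub, trace_add, trace_smul, hσ1, smul_eq_mul, mul_one] at h2
  have c1 : (1 + t : ℂ) = ((1 + t : ℝ) : ℂ) := by push_cast; rfl
  have c2 : (2 * (1 + t : ℂ)) = ((2 * (1 + t) : ℝ) : ℂ) := by push_cast; rfl
  have c3 : ((1 + t : ℂ) ^ 2) = (((1 + t) ^ 2 : ℝ) : ℂ) := by push_cast; rfl
  rw [c1, Complex.re_ofReal_mul] at h3
  rw [c2, c3, Complex.add_re, Complex.sub_re, Complex.re_ofReal_mul, Complex.ofReal_re] at h2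
  have c4 : ((1 : ℂ) + (t ^ 2 : ℝ)) * σ.trace = ((1 + t ^ 2 : ℝ) : ℂ) := by
    rw [hσ1]; push_cast; ring
  rw [c4, Complex.add_re, Complex.ofReal_re]
  nlinarith [mul_nonneg ht0 h1]

lemma exists_symTrace_ketbra_eq (hv : star v ⬝ᵥ v = 1) (hw : star w ⬝ᵥ w = 1) :
    ∃ σ : Matrix n n ℂ, σ.PosSemidef ∧ σ.trace = 1 ∧
    (symTrace (ketbra v) (ketbra w) σ).re = 2 * (1 + overlap v w + overlap v w ^ 2) := by
  obtain ⟨u, hu, huw⟩ := exists_phase_dotProduct v w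
  have hw' : star (u • w) ⬝ᵥ (u • w) = 1 := by
    rw [← trace_ketbra, ketbra_smul hu, trace_ketbra, hw]
  rw [← ketbra_smul hu w]
  simp only [symTrace_ketbra hv hw']
  have hov : overlap v (u • w) = overlap v w := by
    rw [overlap, huw, Complex.norm_real, Real.norm_of_nonneg (overlap_nonneg v w)]
  rw [hov]
  set x := u • w
  set t := overlap v w
  have ht0 : 0 ≤ t := overlap_nonneg v w
  have huw' : star x ⬝ᵥ v = t := by
    rw [star_dotProduct, huw, Complex.star_def, Complex.conj_ofReal]
  have htr : (ketbra (v + x)).trace = 2 * (1 + t : ℂ) := by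
    rw [trace_ketbra, star_add, add_dotProduct, dotProduct_add, dotProduct_add, hv, hw', huw, huw']
    ring
  have hM : (ketbra v + ketbra x) * ketbra (v + x) = (1 + t : ℂ) • ketbra (v + x) := by
    have : (ketbra v + ketbra x) *ᵥ (v + x) = (1 + t : ℂ) • (v + x) := by
      simp only [ketbra, add_mulVec, vecMulVec_mulVec, dotProduct_add, hv, hw', huw, huw']
      ext i
      simp
      ring
    rw [ketbra, ketbra, ketbra, mul_vecMulVec, ← ketbra, ← ketbra, this, smul_vecMulVec]
  have h0 : (2 * (1 + t : ℂ)) ≠ 0 := by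
    have : (2 * (1 + t) : ℝ) ≠ 0 := by positivity
    exact_mod_cast this
  -- The bisector `v + x` is the eigenvector of `M` for the eigenvalue `1 + t`, and its squared norm
  -- is `2 (1 + t)`.
  refine ⟨(((2 * (1 + t))⁻¹ : ℝ) : ℂ) • ketbra (v + x), ?_, ?_, ?_⟩
  · refine (posSemidef_ketbra _).smul ?_
    rw [Complex.zero_le_real]
    positivity
  · rw [trace_smul, htr]
    push_cast
    exact inv_mul_cancel₀ h0
  · rw [mul_smul_comm, mul_assoc, hM, mul_smul_comm, hM, smul_smul, smul_smul, trace_smul,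
      trace_smul, htr, mul_assoc (_ : ℂ) (1 + t : ℂ)]
    have : (1 + ((t ^ 2 : ℝ) : ℂ)) * ((((2 * (1 + t))⁻¹ : ℝ) : ℂ) • (2 * (1 + t : ℂ))) +
        (((2 * (1 + t))⁻¹ : ℝ) * ((1 + t : ℂ) * (1 + t : ℂ))) • (2 * (1 + t : ℂ)) =
        ((2 * (1 + t + t ^ 2) : ℝ) : ℂ) := by
      push_cast
      simp only [smul_eq_mul]
      field_simp
      ring
    rw [this, Complex.ofReal_re]

end RankOne

/-! ### Weighted frames and their deviation from a 2-design. -/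

/-- A resolution of the identity on `ℂ^d` into weighted projectors onto unit vectors. -/
structure WeightedFrame (d : ℕ) (ι : Type*) [Fintype ι] where
  /-- the weights -/
  wt : ι → ℝ
  /-- the unit vectors -/
  vec : ι → Fin d → ℂ
  wt_nonneg : ∀ j, 0 ≤ wt j
  norm_vec : ∀ j, star (vec j) ⬝ᵥ vec j = 1
  sum_eq_one : ∑ j, (wt j : ℂ) • ketbra (vec j) = 1

section TensorSquare

variable {n : Type*} [Fintype n] [DecidableEq n]

/-- The vector `v ⊗ v`. -/
def tensorSq (v : n → ℂ) : n × n → ℂ := fun x => v x.1 * v x.2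

omit [DecidableEq n] in
lemma star_tensorSq_dotProduct (v w : n → ℂ) :
    star (tensorSq v) ⬝ᵥ tensorSq w = (star v ⬝ᵥ w) ^ 2 := by
  simp only [dotProduct, pow_two, Finset.sum_mul_sum, Fintype.sum_prod_type, tensorSq,
    Pi.star_apply, star_mul']
  refine Finset.sum_congr rfl fun i _ => Finset.sum_congr rfl fun j _ => by ring

omit [DecidableEq n] in
lemma overlap_tensorSq (v w : n → ℂ) : overlap (tensorSq v) (tensorSq w) = overlap v w ^ 2 := by
  rw [overlap, star_tensorSq_dotProduct, norm_pow, overlap]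

/-- The sum of the identity and the swap operator on `ℂ^n ⊗ ℂ^n`. -/
def onePlusSwap (n : Type*) [DecidableEq n] : Matrix (n × n) (n × n) ℂ :=
  1 + (1 : Matrix (n × n) (n × n) ℂ).submatrix Prod.swap id

omit [Fintype n] in
lemma onePlusSwap_conjTranspose : (onePlusSwap n)ᴴ = onePlusSwap n := by
  ext x y
  have h1 : y.swap = x ↔ x.swap = y := by rw [Prod.swap_eq_iff_eq_swap, eq_comm]
  have h2 : y = x ↔ x = y := eq_comm
  simp only [onePlusSwap, conjTranspose_apply, Matrix.add_apply, one_apply, submatrix_apply, id, h1, h2,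
    star_add, apply_ite star, star_one, star_zero]

lemma onePlusSwap_mulVec (x : n × n → ℂ) : onePlusSwap n *ᵥ x = fun p => x p + x p.swap := by
  ext p
  simp [onePlusSwap, mulVec, dotProduct, one_apply, add_mul, Finset.sum_add_distrib]

lemma trace_ketbra_tensorSq_mul_onePlusSwap {v : n → ℂ} (hv : star v ⬝ᵥ v = 1) :
    (ketbra (tensorSq v) * onePlusSwap n).trace = 2 := by
  have : onePlusSwap n *ᵥ tensorSq v = (2 : ℂ) • tensorSq v := by
    rw [onePlusSwap_mulVec]
    ext p
    simp [tensorSq]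
    ring
  rw [trace_ketbra_mul, this, dotProduct_smul, star_tensorSq_dotProduct, hv]
  simp

/-- `onePlusSwap` is twice the projector onto the symmetric subspace, whose dimension is `n (n + 1)
/ 2` for `n = Fintype.card n`. -/
lemma trace_onePlusSwap_sq :
    (onePlusSwap n * onePlusSwap n).trace = 2 * (Fintype.card n ^ 2 + Fintype.card n) := by
  have : onePlusSwap n * onePlusSwap n = (2 : ℂ) • onePlusSwap n := by
    refine ext_of_mulVec_single fun i => ?_
    rw [← mulVec_mulVec, smul_mulVec, onePlusSwap_mulVec, onePlusSwap_mulVec]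
    ext p
    simp
    ring
  have h (a b : n) : (b, a) = (a, b) ↔ a = b := by
    simp [Prod.ext_iff, eq_comm]
  have hswap : ((1 : Matrix (n × n) (n × n) ℂ).submatrix Prod.swap id).trace =
      Fintype.card n := by
    simp only [trace, diag_apply, submatrix_apply, one_apply, Fintype.sum_prod_type,
      Prod.swap_prod_mk, id, h, Finset.sum_ite_eq, Finset.mem_univ, if_true, Finset.sum_const,
      Finset.card_univ, nsmul_eq_mul, mul_one]
  rw [this, trace_smul, onePlusSwap, trace_add, trace_one, hswap, Fintype.card_prod, smul_eq_mul]
  push_cast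
  ring

end TensorSquare

namespace WeightedFrame

variable {d : ℕ} {ι κ : Type*} [Fintype ι] [Fintype κ] (F : WeightedFrame d ι)
  (G : WeightedFrame d κ)

lemma sum_wt : ∑ j, F.wt j = d := by
  have h := congrArg trace F.sum_eq_one
  simp only [trace_sum, trace_smul, trace_ketbra, F.norm_vec, trace_one, Fintype.card_fin,
    smul_eq_mul, mul_one] at h
  exact_mod_cast h

lemma sum_wt_overlap {w : Fin d → ℂ} (hw : star w ⬝ᵥ w = 1) :
    ∑ j, F.wt j * overlap (F.vec j) w ^ 2 = 1 := by
  have h := congrArg (fun M => (M * ketbra w).trace) F.sum_eq_one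
  simp only [Finset.sum_mul, trace_sum, smul_mul_assoc, trace_smul, trace_ketbra_mul_ketbra,
    one_mul, trace_ketbra, hw, smul_eq_mul] at h
  exact_mod_cast h

/-- The deviation of a frame from a complex projective `2`-design. -/
noncomputable def designDefect : Matrix (Fin d × Fin d) (Fin d × Fin d) ℂ :=
  ∑ j, (F.wt j : ℂ) • ketbra (tensorSq (F.vec j)) - ((1 / (d + 1) : ℝ) : ℂ) • onePlusSwap (Fin d)

lemma trace_sum_tensorSq_mul_onePlusSwap :
    ((∑ j, (F.wt j : ℂ) • ketbra (tensorSq (F.vec j))) * onePlusSwap (Fin d)).trace =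
      2 * (d : ℂ) := by
  have h : ∑ j, (F.wt j : ℂ) = d := by exact_mod_cast F.sum_wt
  rw [Finset.sum_mul, trace_sum, ← h, Finset.mul_sum]
  refine Finset.sum_congr rfl fun j _ => ?_
  rw [smul_mul_assoc, trace_smul, trace_ketbra_tensorSq_mul_onePlusSwap (F.norm_vec j),
    smul_eq_mul, mul_comm]

/-- The fourth powers arise as squared overlaps of the vectors `v ⊗ v`. For two equal frames this is
the Welch bound on the frame potential, with the slack written as a squared norm. -/
lemma trace_designDefect_mul :
    ((F.designDefect)ᴴ * G.designDefect).trace =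
      ((∑ j, ∑ k, F.wt j * G.wt k * overlap (F.vec j) (G.vec k) ^ 4 - 2 * d / (d + 1) : ℝ) : ℂ) := by
  have hF : (F.designDefect)ᴴ = F.designDefect := by
    simp only [designDefect, conjTranspose_sub, conjTranspose_sum, conjTranspose_smul,
      onePlusSwap_conjTranspose, (posSemidef_ketbra _).isHermitian.eq, Complex.star_def,
      Complex.conj_ofReal]
  have h1 : ((∑ j, (F.wt j : ℂ) • ketbra (tensorSq (F.vec j))) *
      ∑ k, (G.wt k : ℂ) • ketbra (tensorSq (G.vec k))).trace =
      ((∑ j, ∑ k, F.wt j * G.wt k * overlap (F.vec j) (G.vec k) ^ 4 : ℝ) : ℂ) := by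
    simp only [Finset.sum_mul_sum, trace_sum, smul_mul_assoc, mul_smul_comm, trace_smul,
      trace_ketbra_mul_ketbra, overlap_tensorSq, smul_eq_mul]
    push_cast
    refine Finset.sum_congr rfl fun i _ => Finset.sum_congr rfl fun j _ => by ring
  have hd : (d : ℂ) + 1 ≠ 0 := by exact_mod_cast Nat.succ_ne_zero d
  rw [hF, designDefect, designDefect, sub_mul, mul_sub, mul_sub, trace_sub, trace_sub, trace_sub,
    h1, smul_mul_assoc, mul_smul_comm, smul_mul_assoc, mul_smul_comm, trace_smul, trace_smul,
    trace_smul, trace_smul, F.trace_sum_tensorSq_mul_onePlusSwap,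
    trace_mul_comm (onePlusSwap (Fin d)), G.trace_sum_tensorSq_mul_onePlusSwap, trace_onePlusSwap_sq]
  simp only [Fintype.card_fin, smul_eq_mul]
  push_cast
  field_simp
  ring

/-- The total weighted overlap of two frames. -/
noncomputable def totalOverlap : ℝ :=
  ∑ j, ∑ k, F.wt j * G.wt k * overlap (F.vec j) (G.vec k)

lemma sum_wt_mul_wt : ∑ j, ∑ k, F.wt j * G.wt k = (d : ℝ) ^ 2 := by
  simp only [← Finset.mul_sum, ← Finset.sum_mul, sum_wt, pow_two]

lemma sum_wt_mul_wt_overlap_sq :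
    ∑ j, ∑ k, F.wt j * G.wt k * overlap (F.vec j) (G.vec k) ^ 2 = (d : ℝ) := by
  rw [Finset.sum_comm, ← G.sum_wt]
  refine Finset.sum_congr rfl fun k _ => ?_
  have := congrArg (G.wt k * ·) (F.sum_wt_overlap (G.norm_vec k))
  simp only [Finset.mul_sum, mul_one] at this
  refine Eq.trans ?_ this
  refine Finset.sum_congr rfl fun j _ => by ring

end WeightedFrame

/-! ### The bound on the total overlap and its equality case. -/

/-- The overlap `1 / √(d + 1)` of distinct elements of a SIC. -/
noncomputable def sicOverlap (d : ℕ) : ℝ := 1 / Real.sqrt (d + 1)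

lemma sicOverlap_pos (d : ℕ) : 0 < sicOverlap d := by
  unfold sicOverlap; positivity

lemma sicOverlap_sq (d : ℕ) : sicOverlap d ^ 2 = 1 / (d + 1) := by
  rw [sicOverlap, div_pow, Real.sq_sqrt (by positivity), one_pow]

/-- The difference, up to a positive factor, between the quadratic polynomial in `t ^ 2` that
interpolates the square root at the squared overlaps of a SIC, and `t`. -/
noncomputable def overlapGap (d : ℕ) (t : ℝ) : ℝ :=
  (t - sicOverlap d) ^ 2 * (1 - t) * (t + 1 + 2 * sicOverlap d)

lemma overlapGap_nonneg (d : ℕ) {t : ℝ} (h0 : 0 ≤ t) (h1 : t ≤ 1) : 0 ≤ overlapGap d t := by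
  have := sicOverlap_pos d
  have := sub_nonneg.2 h1
  unfold overlapGap
  positivity

lemma eq_or_eq_of_overlapGap_eq_zero {d : ℕ} {t : ℝ} (h0 : 0 ≤ t) (h : overlapGap d t = 0) :
    t = sicOverlap d ∨ t = 1 := by
  have := sicOverlap_pos d
  rcases mul_eq_zero.1 h with h | h
  · rcases mul_eq_zero.1 h with h | h
    · exact .inl (sub_eq_zero.1 (pow_eq_zero_iff two_ne_zero |>.1 h))
    · exact .inr (by linarith)
  · linarith

/-- The total overlap of a SIC with itself. -/
noncomputable def sicTotalOverlap (d : ℕ) : ℝ := 1 + ((d : ℝ) - 1) * Real.sqrt (d + 1)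

namespace WeightedFrame

variable {d : ℕ} {ι κ : Type*} [Fintype ι] [Fintype κ] (F : WeightedFrame d ι)
  (G : WeightedFrame d κ)

lemma overlap_le_one (j : ι) (k : κ) : overlap (F.vec j) (G.vec k) ≤ 1 :=
  QMeas.overlap_le_one (F.norm_vec j) (G.norm_vec k)

/-- Summing `overlapGap` over all pairs trades the total overlap for the fixed sums of `1` and `t²`
and the sum of `t⁴`, which is the defect term up to a constant. -/
lemma totalOverlap_add_gap :
    2 * sicOverlap d * (1 + sicOverlap d) ^ 2 * F.totalOverlap G +
      ((F.designDefect)ᴴ * G.designDefect).trace.re +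
      ∑ j, ∑ k, F.wt j * G.wt k * overlapGap d (overlap (F.vec j) (G.vec k)) =
    2 * sicOverlap d * (1 + sicOverlap d) ^ 2 * sicTotalOverlap d := by
  rw [trace_designDefect_mul, Complex.ofReal_re]
  have h0 := F.sum_wt_mul_wt G
  have h2 := F.sum_wt_mul_wt_overlap_sq G
  set s := sicOverlap d
  -- The root `-(1 + 2 s)` of `overlapGap` is the one that cancels the cubic term, whose weighted
  -- sum would be out of control.
  have hpt (j : ι) (k : κ) : F.wt j * G.wt k * overlapGap d (overlap (F.vec j) (G.vec k)) =
      s ^ 2 * (1 + 2 * s) * (F.wt j * G.wt k) +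
      (1 + 2 * s + 3 * s ^ 2) * (F.wt j * G.wt k * overlap (F.vec j) (G.vec k) ^ 2) -
      F.wt j * G.wt k * overlap (F.vec j) (G.vec k) ^ 4 -
      2 * s * (1 + s) ^ 2 * (F.wt j * G.wt k * overlap (F.vec j) (G.vec k)) := by
    rw [overlapGap]; ring
  have hsum : ∑ j, ∑ k, F.wt j * G.wt k * overlapGap d (overlap (F.vec j) (G.vec k)) =
      s ^ 2 * (1 + 2 * s) * d ^ 2 + (1 + 2 * s + 3 * s ^ 2) * d -
      ∑ j, ∑ k, F.wt j * G.wt k * overlap (F.vec j) (G.vec k) ^ 4 -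
      2 * s * (1 + s) ^ 2 * F.totalOverlap G := by
    simp only [hpt, Finset.sum_sub_distrib, Finset.sum_add_distrib, ← Finset.mul_sum]
    simp only [← Finset.mul_sum] at h0 h2
    rw [h0, h2, totalOverlap]
  rw [hsum]
  have hs0 : 0 < s := sicOverlap_pos d
  have hsq : s ^ 2 * (d + 1) = 1 := by
    rw [sicOverlap_sq]; exact one_div_mul_cancel (by positivity)
  have hroot : Real.sqrt (d + 1) = 1 / s := by
    simp [s, sicOverlap]
  have hd : (d : ℝ) = 1 / s ^ 2 - 1 := by
    rw [eq_sub_iff_add_eq, eq_div_iff (by positivity), mul_comm, hsq]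
  rw [sicTotalOverlap, hroot, hd]
  field_simp
  ring

lemma sum_overlapGap_nonneg :
    0 ≤ ∑ j, ∑ k, F.wt j * G.wt k * overlapGap d (overlap (F.vec j) (G.vec k)) :=
  Finset.sum_nonneg fun j _ => Finset.sum_nonneg fun k _ =>
    mul_nonneg (mul_nonneg (F.wt_nonneg j) (G.wt_nonneg k))
      (overlapGap_nonneg d (overlap_nonneg _ _) (F.overlap_le_one G j k))

lemma designDefect_eq_zero_of_le (h : sicTotalOverlap d ≤ F.totalOverlap F) :
    F.designDefect = 0 := by
  have h1 := F.totalOverlap_add_gap F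
  have h2 := F.sum_overlapGap_nonneg F
  have h3 := (posSemidef_conjTranspose_mul_self F.designDefect).trace_nonneg
  have hs := sicOverlap_pos d
  have h4 : 2 * sicOverlap d * (1 + sicOverlap d) ^ 2 * sicTotalOverlap d ≤
      2 * sicOverlap d * (1 + sicOverlap d) ^ 2 * F.totalOverlap F :=
    mul_le_mul_of_nonneg_left h (by positivity)
  obtain ⟨h5, h6⟩ := Complex.le_def.1 h3
  refine trace_conjTranspose_mul_self_eq_zero_iff.1 (Complex.ext ?_ h6.symm)
  refine le_antisymm ?_ h5
  rw [Complex.zero_re]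
  linarith

/-- One vanishing defect suffices to kill the cross term. The gap sum is then nonpositive with
nonnegative terms, so every term is zero. -/
lemma overlap_eq_or_eq_of_le (hF : F.designDefect = 0)
    (h : sicTotalOverlap d ≤ F.totalOverlap G) {j : ι} {k : κ} (hj : 0 < F.wt j)
    (hk : 0 < G.wt k) : overlap (F.vec j) (G.vec k) = sicOverlap d ∨
      overlap (F.vec j) (G.vec k) = 1 := by
  refine eq_or_eq_of_overlapGap_eq_zero (overlap_nonneg _ _) ?_
  have h1 := F.totalOverlap_add_gap G
  rw [hF] at h1
  simp only [conjTranspose_zero, zero_mul, trace_zero, Complex.zero_re, add_zero] at h1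
  have hs := sicOverlap_pos d
  have h4 : 2 * sicOverlap d * (1 + sicOverlap d) ^ 2 * sicTotalOverlap d ≤
      2 * sicOverlap d * (1 + sicOverlap d) ^ 2 * F.totalOverlap G :=
    mul_le_mul_of_nonneg_left h (by positivity)
  have hterm (j : ι) (k : κ) :
      0 ≤ F.wt j * G.wt k * overlapGap d (overlap (F.vec j) (G.vec k)) :=
    mul_nonneg (mul_nonneg (F.wt_nonneg j) (G.wt_nonneg k))
      (overlapGap_nonneg d (overlap_nonneg _ _) (F.overlap_le_one G j k))
  have h5 := le_antisymm (by linarith) (F.sum_overlapGap_nonneg G)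
  rw [Finset.sum_eq_zero_iff_of_nonneg fun j _ => Finset.sum_nonneg fun k _ => hterm j k] at h5
  have h6 := h5 j (Finset.mem_univ j)
  rw [Finset.sum_eq_zero_iff_of_nonneg fun k _ => hterm j k] at h6
  exact (mul_eq_zero.1 (h6 k (Finset.mem_univ k))).resolve_left (mul_pos hj hk).ne'

end WeightedFrame

/-! ### Fidelity bounds from rank-one refinements. -/

section SymTrace

variable {n : Type*} [Fintype n]

lemma symTrace_swap (A B C : Matrix n n ℂ) : symTrace A B C = symTrace B A C := by
  rw [symTrace, symTrace, trace_mul_comm A B]; ring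

lemma symTrace_sum_smul_left {τ : Type*} [Fintype τ] (a : τ → ℝ) (P : τ → Matrix n n ℂ)
    (B C : Matrix n n ℂ) :
    symTrace (∑ i, (a i : ℂ) • P i) B C = ∑ i, (a i : ℂ) * symTrace (P i) B C := by
  simp only [symTrace, Finset.sum_mul, Finset.mul_sum, smul_mul_assoc, mul_smul_comm, trace_sum,
    trace_smul, smul_eq_mul, ← Finset.sum_add_distrib]
  refine Finset.sum_congr rfl fun i _ => by ring

lemma re_symTrace_sum_smul {τ υ : Type*} [Fintype τ] [Fintype υ] (a : τ → ℝ) (b : υ → ℝ)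
    (P : τ → Matrix n n ℂ) (Q : υ → Matrix n n ℂ) (C : Matrix n n ℂ) :
    (symTrace (∑ i, (a i : ℂ) • P i) (∑ k, (b k : ℂ) • Q k) C).re =
      ∑ i, ∑ k, a i * b k * (symTrace (P i) (Q k) C).re := by
  rw [symTrace_sum_smul_left, Complex.re_sum]
  refine Finset.sum_congr rfl fun i _ => ?_
  rw [Complex.re_ofReal_mul, symTrace_swap, symTrace_sum_smul_left, Complex.re_sum, Finset.mul_sum]
  refine Finset.sum_congr rfl fun k _ => ?_
  rw [Complex.re_ofReal_mul, symTrace_swap, mul_assoc]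

end SymTrace

lemma F2iid_eq (d : ℕ) : F2iid d =
    1 / (d * (d + 1) * (d + 2)) * (2 * ((d : ℝ) ^ 2 + d + sicTotalOverlap d)) := by
  rw [F2iid, sicTotalOverlap]; ring

namespace WeightedFrame

variable {d : ℕ} {ι κ τ υ : Type*} [Fintype ι] [Fintype κ] [Fintype τ] [Fintype υ]

lemma sum_fidelity (F : WeightedFrame d ι) (G : WeightedFrame d κ) :
    ∑ j, ∑ k, F.wt j * G.wt k *
      (2 * (1 + overlap (F.vec j) (G.vec k) + overlap (F.vec j) (G.vec k) ^ 2)) =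
    2 * ((d : ℝ) ^ 2 + d + F.totalOverlap G) := by
  have h0 := F.sum_wt_mul_wt G
  have h2 := F.sum_wt_mul_wt_overlap_sq G
  have h (j : ι) (k : κ) : F.wt j * G.wt k *
      (2 * (1 + overlap (F.vec j) (G.vec k) + overlap (F.vec j) (G.vec k) ^ 2)) =
      2 * (F.wt j * G.wt k + F.wt j * G.wt k * overlap (F.vec j) (G.vec k) ^ 2 +
        F.wt j * G.wt k * overlap (F.vec j) (G.vec k)) := by ring
  simp only [h, ← Finset.mul_sum, Finset.sum_add_distrib]
  simp only [← Finset.mul_sum] at h0 h2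
  rw [h0, h2, totalOverlap]

/-- The elements of the POVM `A` are sums of the weighted projectors of the frame. -/
def Refines (F : WeightedFrame d (ι × τ)) (A : POVM (Fin d) ι) : Prop :=
  ∀ j, A.elem j = ∑ i, (F.wt (j, i) : ℂ) • ketbra (F.vec (j, i))

/-- The estimator is shared by all spectral pairs of an outcome, while the bound optimizes each pair
separately; hence an inequality, which needs no rank assumption. -/
lemma Refines.averageFidelity_le [NeZero d] {F : WeightedFrame d (ι × τ)}
    {G : WeightedFrame d (κ × υ)} {A : POVM (Fin d) ι} {B : POVM (Fin d) κ} (hF : F.Refines A)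
    (hG : G.Refines B) {σ : ι × κ → Matrix (Fin d) (Fin d) ℂ} (hσ : ∀ p, IsDensity (σ p)) :
    averageFidelity (A.prod B) σ ≤
      1 / (d * (d + 1) * (d + 2)) * (2 * ((d : ℝ) ^ 2 + d + F.totalOverlap G)) := by
  rw [averageFidelity_prod A B fun p => (hσ p).1.isHermitian, ← sum_fidelity]
  refine mul_le_mul_of_nonneg_left ?_ (by positivity)
  simp only [Fintype.sum_prod_type]
  refine Finset.sum_le_sum fun j _ => ?_
  rw [Finset.sum_comm]
  refine Finset.sum_le_sum fun k _ => ?_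
  rw [hF j, hG k, re_symTrace_sum_smul]
  refine Finset.sum_le_sum fun i _ => Finset.sum_le_sum fun l _ => ?_
  exact mul_le_mul_of_nonneg_left
    (symTrace_ketbra_le (F.norm_vec _) (G.norm_vec _) (hσ _).1 (hσ _).2)
    (mul_nonneg (F.wt_nonneg _) (G.wt_nonneg _))

lemma _root_.QMeas.exists_isDensity (d : ℕ) [NeZero d] :
    ∃ σ : Matrix (Fin d) (Fin d) ℂ, IsDensity σ := by
  refine ⟨ketbra (Pi.single 0 1), posSemidef_ketbra _, ?_⟩
  simp [trace_ketbra]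

lemma Refines.estimationFidelity_le [NeZero d] {F : WeightedFrame d (ι × τ)}
    {G : WeightedFrame d (κ × υ)} {A : POVM (Fin d) ι} {B : POVM (Fin d) κ} (hF : F.Refines A)
    (hG : G.Refines B) : estimationFidelity (A.prod B) ≤
      1 / (d * (d + 1) * (d + 2)) * (2 * ((d : ℝ) ^ 2 + d + F.totalOverlap G)) := by
  obtain ⟨σ, hσ⟩ := exists_isDensity d
  refine csSup_le ⟨_, fun _ => σ, fun _ => hσ, rfl⟩ ?_
  rintro _ ⟨σ, hσ, rfl⟩
  exact hF.averageFidelity_le hG hσ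

lemma Refines.sicTotalOverlap_le [NeZero d] {F : WeightedFrame d (ι × τ)}
    {G : WeightedFrame d (κ × υ)} {A : POVM (Fin d) ι} {B : POVM (Fin d) κ} (hF : F.Refines A)
    (hG : G.Refines B) (h : estimationFidelity (A.prod B) = F2iid d) :
    sicTotalOverlap d ≤ F.totalOverlap G := by
  have h1 := hF.estimationFidelity_le hG
  have hd : (0 : ℝ) < d := by exact_mod_cast NeZero.pos d
  rw [h, F2iid_eq] at h1
  have := le_of_mul_le_mul_left h1 (by positivity)
  linarith

/-- The fidelity of a product of two POVMs of rank one. -/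
lemma estimationFidelity_eq [NeZero d] (F : WeightedFrame d ι) (G : WeightedFrame d κ)
    {A : POVM (Fin d) ι} {B : POVM (Fin d) κ}
    (hF : ∀ j, A.elem j = (F.wt j : ℂ) • ketbra (F.vec j))
    (hG : ∀ k, B.elem k = (G.wt k : ℂ) • ketbra (G.vec k)) : estimationFidelity (A.prod B) =
      1 / (d * (d + 1) * (d + 2)) * (2 * ((d : ℝ) ^ 2 + d + F.totalOverlap G)) := by
  have hre (p : ι × κ) (σ : Matrix (Fin d) (Fin d) ℂ) :
      (symTrace (A.elem p.1) (B.elem p.2) σ).re = F.wt p.1 * G.wt p.2 *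
        (symTrace (ketbra (F.vec p.1)) (ketbra (G.vec p.2)) σ).re := by
    have := re_symTrace_sum_smul (fun _ : Unit => F.wt p.1) (fun _ : Unit => G.wt p.2)
      (fun _ => ketbra (F.vec p.1)) (fun _ => ketbra (G.vec p.2)) σ
    simpa [hF, hG] using this
  -- With a single pair of vectors per outcome, the pairwise optimal estimators can be used
  -- simultaneously.
  refine IsGreatest.csSup_eq ⟨?_, ?_⟩
  · choose σ hσ0 hσ1 hσ using fun p : ι × κ =>
      exists_symTrace_ketbra_eq (F.norm_vec p.1) (G.norm_vec p.2)
    refine ⟨σ, fun p => ⟨hσ0 p, hσ1 p⟩, ?_⟩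
    rw [averageFidelity_prod A B fun p => (hσ0 p).isHermitian, ← sum_fidelity]
    simp only [hre, hσ, Fintype.sum_prod_type]
  · rintro _ ⟨σ, hσ, rfl⟩
    rw [averageFidelity_prod A B fun p => (hσ p).1.isHermitian, ← sum_fidelity]
    refine mul_le_mul_of_nonneg_left ?_ (by positivity)
    simp only [hre, Fintype.sum_prod_type]
    refine Finset.sum_le_sum fun j _ => Finset.sum_le_sum fun k _ => ?_
    exact mul_le_mul_of_nonneg_left
      (symTrace_ketbra_le (F.norm_vec _) (G.norm_vec _) (hσ _).1 (hσ _).2)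
      (mul_nonneg (F.wt_nonneg _) (G.wt_nonneg _))

/-- Every POVM has a refinement consisting of spectral projectors. -/
lemma exists_refines (A : POVM (Fin d) ι) : ∃ F : WeightedFrame d (ι × Fin d), F.Refines A ∧
    ∀ j i l, i ≠ l → overlap (F.vec (j, i)) (F.vec (j, l)) = 0 := by
  let V := fun j => ((A.posSemidef j).isHermitian.eigenvectorUnitary : Matrix (Fin d) (Fin d) ℂ)
  let l := fun j => (A.posSemidef j).isHermitian.eigenvalues
  have hVV (j : ι) : (V j)ᴴ * V j = 1 := mem_unitaryGroup_iff'.1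
    (A.posSemidef j).isHermitian.eigenvectorUnitary.2
  have hdot (j : ι) (i k : Fin d) :
      star (fun m => V j m i) ⬝ᵥ (fun m => V j m k) = (1 : Matrix (Fin d) (Fin d) ℂ) i k := by
    rw [← hVV j]; rfl
  have hA (j : ι) : A.elem j = ∑ i, (l j i : ℂ) • ketbra (fun m => V j m i) := by
    have h : A.elem j = V j * diagonal (fun i => (l j i : ℂ)) * (V j)ᴴ := by
      conv_lhs => rw [(A.posSemidef j).isHermitian.spectral_theorem]
      rfl
    rw [h]
    ext p q
    rw [mul_apply]
    simp only [mul_diagonal, conjTranspose_apply, Matrix.sum_apply, Matrix.smul_apply, ketbra,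
      vecMulVec_apply, Pi.star_apply, smul_eq_mul]
    refine Finset.sum_congr rfl fun i _ => by ring
  refine ⟨⟨fun p => l p.1 p.2, fun p m => V p.1 m p.2,
    fun p => (A.posSemidef p.1).eigenvalues_nonneg p.2, fun p => by rw [hdot, one_apply_eq], ?_⟩,
    hA, fun j i k hik => by simp only [overlap]; rw [hdot, one_apply_ne hik, norm_zero]⟩
  rw [Fintype.sum_prod_type, ← A.sum_eq_one]
  exact Finset.sum_congr rfl fun j _ => (hA j).symm

end WeightedFrame

/-! ### Rigidity: simple POVMs attaining the bound. -/

section Simple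

variable {d : ℕ} [NeZero d] {ι κ : Type*} [Fintype ι] [Fintype κ]

lemma POVM.IsSimple.elem_ne_zero {A : POVM (Fin d) ι} (hA : A.IsSimple) (j : ι) :
    A.elem j ≠ 0 := by
  by_cases h : ∃ k, k ≠ j
  · obtain ⟨k, hk⟩ := h
    simpa using (hA hk.symm).ne_zero 0
  -- With a single outcome simplicity is vacuous, but the element is then the identity.
  · push Not at h
    intro h0
    have h1 := A.sum_eq_one
    rw [Finset.sum_eq_zero fun k _ => by rw [h k, h0]] at h1
    exact zero_ne_one h1

lemma POVM.IsSimple.eq_of_smul {A : POVM (Fin d) ι} (hA : A.IsSimple) {j k : ι}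
    {M : Matrix (Fin d) (Fin d) ℂ} {a b : ℂ} (hj : A.elem j = a • M) (hk : A.elem k = b • M) :
    j = k := by
  by_contra h
  have ha : a ≠ 0 := by
    rintro rfl
    exact hA.elem_ne_zero j (by rw [hj, zero_smul])
  have := LinearIndependent.pair_iff.1 (hA h) b (-a)
    (by rw [hj, hk, smul_smul, smul_smul, ← add_smul]; simp [mul_comm])
  exact ha (neg_eq_zero.1 this.2)

namespace WeightedFrame

/-- The elements of the POVM `A` are the weighted projectors of the frame. -/
def Represents (F : WeightedFrame d ι) (A : POVM (Fin d) ι) : Prop :=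
  ∀ j, A.elem j = (F.wt j : ℂ) • ketbra (F.vec j)

/-- If no two projectors refining the same element of a simple POVM occur simultaneously, then
the POVM has rank one. -/
lemma Refines.exists_represents {τ : Type*} [Fintype τ] {F : WeightedFrame d (ι × τ)}
    {A : POVM (Fin d) ι} (hF : F.Refines A) (hA : A.IsSimple)
    (h : ∀ j i l, 0 < F.wt (j, i) → 0 < F.wt (j, l) → i = l) :
    ∃ G : WeightedFrame d ι, G.Represents A ∧
      ∀ j, ∃ i, G.vec j = F.vec (j, i) ∧ 0 < F.wt (j, i) := by
  have hpos (j : ι) : ∃ i, 0 < F.wt (j, i) := by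
    by_contra! hj
    refine hA.elem_ne_zero j ?_
    rw [hF j]
    refine Finset.sum_eq_zero fun i _ => ?_
    rw [le_antisymm (hj i) (F.wt_nonneg _), Complex.ofReal_zero, zero_smul]
  choose f hf using hpos
  have hrep (j : ι) : A.elem j = (F.wt (j, f j) : ℂ) • ketbra (F.vec (j, f j)) := by
    rw [hF j]
    refine Finset.sum_eq_single _ (fun i _ hi => ?_) (by simp)
    have : F.wt (j, i) = 0 := by
      refine le_antisymm (not_lt.1 fun hlt => hi (h j i (f j) hlt (hf j))) (F.wt_nonneg _)
    rw [this, Complex.ofReal_zero, zero_smul]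
  refine ⟨⟨fun j => F.wt (j, f j), fun j => F.vec (j, f j), fun j => F.wt_nonneg _,
    fun j => F.norm_vec _, ?_⟩, hrep, fun j => ⟨f j, rfl, hf j⟩⟩
  rw [← A.sum_eq_one]
  exact Finset.sum_congr rfl fun j _ => (hrep j).symm

variable {F : WeightedFrame d ι} {A : POVM (Fin d) ι}

/-- Testing completeness on the `j`-th vector gives `w + (d - w) / (d + 1) = 1` for its weight `w`.
-/
lemma wt_eq_of_overlap (h : ∀ j k, j ≠ k → overlap (F.vec j) (F.vec k) = sicOverlap d) (j : ι) :
    F.wt j = 1 / d := by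
  classical
  have h1 := F.sum_wt_overlap (F.norm_vec j)
  have h2 := F.sum_wt
  rw [← Finset.add_sum_erase _ _ (Finset.mem_univ j)] at h1 h2
  have h3 : ∑ k ∈ Finset.univ.erase j, F.wt k * overlap (F.vec k) (F.vec j) ^ 2 =
      (∑ k ∈ Finset.univ.erase j, F.wt k) * (1 / (d + 1)) := by
    rw [Finset.sum_mul]
    refine Finset.sum_congr rfl fun k hk => ?_
    rw [h k j (Finset.ne_of_mem_erase hk), sicOverlap_sq]
  rw [h3, overlap_self (F.norm_vec j)] at h1
  have hd : (0 : ℝ) < d := by exact_mod_cast NeZero.pos d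
  rw [← eq_sub_iff_add_eq'] at h2
  rw [h2] at h1
  field_simp at h1 ⊢
  linarith

lemma card_eq_of_overlap (h : ∀ j k, j ≠ k → overlap (F.vec j) (F.vec k) = sicOverlap d) :
    Fintype.card ι = d ^ 2 := by
  have h1 := F.sum_wt
  simp only [wt_eq_of_overlap h, Finset.sum_const, Finset.card_univ, nsmul_eq_mul] at h1
  have hd : (0 : ℝ) < d := by exact_mod_cast NeZero.pos d
  rw [mul_one_div, div_eq_iff hd.ne', ← pow_two] at h1
  exact_mod_cast h1

lemma Represents.isSIC (hF : F.Represents A)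
    (h : ∀ j k, j ≠ k → overlap (F.vec j) (F.vec k) = sicOverlap d) : A.IsSIC := by
  refine ⟨card_eq_of_overlap h, F.vec, fun j => ?_, fun j k => ?_⟩
  · rw [hF j, wt_eq_of_overlap h, ketbra]
    push_cast
    rfl
  · change overlap (F.vec j) (F.vec k) ^ 2 = _
    have hd : (d : ℝ) + 1 ≠ 0 := by positivity
    split_ifs with hjk
    · rw [hjk, overlap_self (F.norm_vec k), mul_one, div_self hd, one_pow]
    · rw [h j k hjk, sicOverlap_sq, mul_zero, zero_add]

lemma Represents.overlap_ne_one (hF : F.Represents A) (hA : A.IsSimple) {j k : ι} (hjk : j ≠ k) :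
    overlap (F.vec j) (F.vec k) ≠ 1 := by
  intro h
  have := ketbra_eq_of_overlap_eq_one (F.norm_vec j) (F.norm_vec k) h
  exact hjk (hA.eq_of_smul (hF j) (by rw [this]; exact hF k))

/-- If all overlaps with a fixed unit vector are one or the overlap of a SIC, then one of the
projectors is the projector onto this vector. -/
lemma exists_ketbra_eq {w : Fin d → ℂ} (hw : star w ⬝ᵥ w = 1)
    (h : ∀ j, overlap (F.vec j) w = sicOverlap d ∨ overlap (F.vec j) w = 1) :
    ∃ j, ketbra (F.vec j) = ketbra w := by
  by_contra! hne
  -- If all overlaps were `s`, completeness would read `d / (d + 1) = 1`.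
  have h1 := F.sum_wt_overlap hw
  have h2 (j : ι) : overlap (F.vec j) w ^ 2 = 1 / (d + 1) := by
    rw [(h j).resolve_right fun h1 => hne j (ketbra_eq_of_overlap_eq_one (F.norm_vec j) hw h1),
      sicOverlap_sq]
  simp only [h2, ← Finset.sum_mul, F.sum_wt] at h1
  have hd : (0 : ℝ) < d := by exact_mod_cast NeZero.pos d
  field_simp at h1
  linarith

lemma _root_.QMeas.overlap_congr {n : Type*} [Fintype n] {v v' w w' : n → ℂ}
    (hv : ketbra v = ketbra v') (hw : ketbra w = ketbra w') : overlap v w = overlap v' w' := by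
  have h := trace_ketbra_mul_ketbra v w
  rw [hv, hw, trace_ketbra_mul_ketbra] at h
  have h' : overlap v' w' ^ 2 = overlap v w ^ 2 := by exact_mod_cast h
  exact ((sq_eq_sq₀ (overlap_nonneg _ _) (overlap_nonneg _ _)).1 h').symm

end WeightedFrame

open WeightedFrame

/-- A simple POVM whose two-fold fidelity is that of a SIC has a rank-one representation with the
overlaps of a SIC, obtained from a refinement with vanishing design defect. -/
lemma exists_represents_of_estimationFidelity_eq {A : POVM (Fin d) ι} (hA : A.IsSimple)
    (h : estimationFidelity (A.prod A) = F2iid d) :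
    ∃ (F : WeightedFrame d (ι × Fin d)) (G : WeightedFrame d ι), F.Refines A ∧
      F.designDefect = 0 ∧ G.Represents A ∧
      (∀ j, ∃ i, G.vec j = F.vec (j, i) ∧ 0 < F.wt (j, i)) ∧
      ∀ j k, j ≠ k → overlap (G.vec j) (G.vec k) = sicOverlap d := by
  obtain ⟨F, hF, horth⟩ := exists_refines A
  have hle := hF.sicTotalOverlap_le hF h
  have h0 := F.designDefect_eq_zero_of_le hle
  have hov {p q : ι × Fin d} (hp : 0 < F.wt p) (hq : 0 < F.wt q) :=
    F.overlap_eq_or_eq_of_le F h0 hle hp hq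
  -- Two eigenvectors of one element have overlap `0`, which is neither `s` nor `1`.
  obtain ⟨G, hG, hGF⟩ := hF.exists_represents hA fun j i l hi hl => by
    by_contra hil
    have := horth j i l hil
    rcases hov hi hl with h1 | h1
    · exact (sicOverlap_pos d).ne (by rw [← h1, this])
    · exact zero_ne_one (by rw [← this, h1])
  refine ⟨F, G, hF, h0, hG, hGF, fun j k hjk => ?_⟩
  · obtain ⟨i, h1, h3⟩ := hGF j
    obtain ⟨l, h4, h6⟩ := hGF k
    have hne := hG.overlap_ne_one hA hjk
    rw [h1, h4] at hne ⊢
    exact (hov h3 h6).resolve_right hne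

lemma isSIC_of_estimationFidelity_eq {A : POVM (Fin d) ι} {B : POVM (Fin d) κ} (hA : A.IsSimple)
    (hB : B.IsSimple) (hAA : estimationFidelity (A.prod A) = F2iid d)
    (hAB : estimationFidelity (A.prod B) = F2iid d) :
    A.IsSIC ∧ B.IsSIC ∧ A.IdenticalUpToRelabeling B := by
  obtain ⟨F, G, hF, h0, hG, hGF, hGG⟩ := exists_represents_of_estimationFidelity_eq hA hAA
  obtain ⟨H, hH, horth⟩ := exists_refines B
  have hle := hF.sicTotalOverlap_le hH hAB
  -- The defect of `H` is unknown; that of `F` vanishes, which is enough to restrict the cross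
  -- overlaps.
  have hmatch (q : κ × Fin d) (hq : 0 < H.wt q) : ∃ j, ketbra (G.vec j) = ketbra (H.vec q) := by
    refine G.exists_ketbra_eq (H.norm_vec q) fun j => ?_
    obtain ⟨i, h1, h2⟩ := hGF j
    rw [h1]
    exact F.overlap_eq_or_eq_of_le H h0 hle h2 hq
  have hpos := sicOverlap_pos d
  -- Eigenvectors of `B` inherit the overlaps of `A`, so orthogonal ones cannot refine the same
  -- element.
  obtain ⟨K, hK, hKH⟩ := hH.exists_represents hB fun k i l hi hl => by
    by_contra hil
    have hz := horth k i l hil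
    obtain ⟨j, hj⟩ := hmatch _ hi
    obtain ⟨j', hj'⟩ := hmatch _ hl
    rw [← overlap_congr hj hj'] at hz
    by_cases hjj : j = j'
    · rw [hjj, overlap_self (G.norm_vec j')] at hz
      exact one_ne_zero hz
    · exact hpos.ne (by rw [← hGG j j' hjj, hz])
  have hmatch' (k : κ) : ∃ j, ketbra (G.vec j) = ketbra (K.vec k) := by
    obtain ⟨i, h1, h2⟩ := hKH k
    rw [h1]
    exact hmatch _ h2
  choose f hf using hmatch'
  have hinj : Function.Injective f := fun k k' hk =>
    hB.eq_of_smul (hK k) (by rw [← hf k, hk, hf k']; exact hK k')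
  have hKK (k k' : κ) (hk : k ≠ k') : overlap (K.vec k) (K.vec k') = sicOverlap d := by
    rw [← overlap_congr (hf k) (hf k'), hGG _ _ (hinj.ne hk)]
  refine ⟨hG.isSIC hGG, hK.isSIC hKK, ?_⟩
  -- Both SICs have `d ^ 2` elements, so the injective matching is onto.
  have hbij : Function.Bijective f := (Fintype.bijective_iff_injective_and_card f).2
    ⟨hinj, by rw [card_eq_of_overlap hGG, card_eq_of_overlap hKK]⟩
  refine ⟨(Equiv.ofBijective f hbij).symm, fun j => ?_⟩
  obtain ⟨k, rfl⟩ := hbij.2 j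
  rw [Equiv.ofBijective_symm_apply_apply, hG, hK, wt_eq_of_overlap hGG, wt_eq_of_overlap hKK, hf]

/-! ### The value attained by a SIC. -/

/-- The fidelity of the product of two identical SICs. -/
lemma POVM.IsSIC.estimationFidelity_eq {A : POVM (Fin d) ι} {B : POVM (Fin d) κ} (hA : A.IsSIC)
    (hAB : A.IdenticalUpToRelabeling B) : estimationFidelity (A.prod B) = F2iid d := by
  classical
  obtain ⟨hcard, ψ, hψ, hov⟩ := hA
  obtain ⟨e, he⟩ := hAB
  have hd : (0 : ℝ) < d := by exact_mod_cast NeZero.pos d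
  have hnorm (j : ι) : star (ψ j) ⬝ᵥ ψ j = 1 := by
    have h := hov j j
    rw [if_pos rfl, mul_one, div_self (by positivity)] at h
    have h1 : ‖star (ψ j) ⬝ᵥ ψ j‖ = 1 :=
      (pow_eq_one_iff_of_nonneg (norm_nonneg _) two_ne_zero).1 h
    rw [Complex.eq_coe_norm_of_nonneg (dotProduct_star_self_nonneg (ψ j)), h1, Complex.ofReal_one]
  have hoff (j k : ι) (hjk : j ≠ k) : overlap (ψ j) (ψ k) = sicOverlap d := by
    have h := hov j k
    rw [if_neg hjk, mul_zero, zero_add, ← sicOverlap_sq] at h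
    exact (sq_eq_sq₀ (overlap_nonneg _ _) (sicOverlap_pos d).le).1 h
  have hrep (j : ι) : A.elem j = ((1 / d : ℝ) : ℂ) • ketbra (ψ j) := by
    rw [hψ j, ketbra]; push_cast; rfl
  have hrep' (k : κ) : B.elem k = ((1 / d : ℝ) : ℂ) • ketbra (ψ (e.symm k)) := by
    rw [← hrep, he, Equiv.apply_symm_apply]
  let F : WeightedFrame d ι := ⟨fun _ => 1 / d, ψ, fun _ => by positivity, hnorm, by
    rw [← A.sum_eq_one]; exact Finset.sum_congr rfl fun j _ => (hrep j).symm⟩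
  let G : WeightedFrame d κ := ⟨fun _ => 1 / d, fun k => ψ (e.symm k), fun _ => by positivity,
    fun k => hnorm _, by
    rw [← B.sum_eq_one]; exact Finset.sum_congr rfl fun j _ => (hrep' j).symm⟩
  rw [WeightedFrame.estimationFidelity_eq F G hrep hrep', F2iid_eq]
  congr 3
  -- Each row has one overlap equal to `1` and `d ^ 2 - 1` equal to `s`.
  have hrow (j : ι) : ∑ k, overlap (ψ j) (ψ (e.symm k)) = 1 + ((d : ℝ) ^ 2 - 1) * sicOverlap d := by
    rw [e.symm.sum_comp fun k => overlap (ψ j) (ψ k),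
      ← Finset.add_sum_erase _ _ (Finset.mem_univ j), overlap_self (hnorm j),
      Finset.sum_congr rfl fun k hk => hoff j k (Finset.ne_of_mem_erase hk).symm,
      Finset.sum_const, Finset.card_erase_of_mem (Finset.mem_univ j), Finset.card_univ, hcard,
      nsmul_eq_mul, Nat.cast_sub (Nat.one_le_pow _ _ (NeZero.pos d))]
    push_cast; rfl
  simp only [totalOverlap, F, G, ← Finset.mul_sum, hrow, Finset.sum_const, Finset.card_univ, hcard,
    nsmul_eq_mul, sicTotalOverlap, sicOverlap]
  have hs : 0 < Real.sqrt (d + 1) := by positivity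
  have hsq : Real.sqrt (d + 1) ^ 2 = d + 1 := Real.sq_sqrt (by positivity)
  push_cast
  field_simp
  linear_combination (1 - (d : ℝ)) * hsq

end Simple

end QMeas

theorem corollary5 {d : ℕ} [NeZero d] {ι κ : Type*} [Fintype ι] [Fintype κ]
    (A : QMeas.POVM (Fin d) ι) (B : QMeas.POVM (Fin d) κ)
    (hA : A.IsSimple) (hB : B.IsSimple) :
    (A.IsSIC ∧ B.IsSIC ∧ A.IdenticalUpToRelabeling B) ↔
      (QMeas.estimationFidelity (A.prod B) = QMeas.estimationFidelity (A.prod A) ∧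
        QMeas.estimationFidelity (A.prod A) = QMeas.F2iid d) := by
  constructor
  · rintro ⟨hSA, -, hAB⟩
    have h := hSA.estimationFidelity_eq ⟨Equiv.refl ι, fun _ => rfl⟩
    exact ⟨by rw [h, hSA.estimationFidelity_eq hAB], h⟩
  · rintro ⟨h1, h2⟩
    exact QMeas.isSIC_of_estimationFidelity_eq hA hB h2 (h1.trans h2)
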